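/- Consider edge-to-edge tilings of the unit sphere by $f$ congruent simple geodesic quadrilaterals $ABCD$ (reflected copies allowed) in which every vertex has degree at least $3$, where the tile has edge lengths $|AB|=|DA|=a$, $|BC|=b$, $|CD|=c$ with $a,b,c$ distinct, and interior angles $\alpha,\beta,\gamma,\delta\in(0,2\pi)$ at $A,B,C,D$. A vertex of the tiling is written $\alpha^{k}\beta^{l}\gamma^{m}\delta^{n}$ if exactly $k,l,m,n$ tiles have, respectively, their corner $A,B,C,D$ there. Proposition. If both $\alpha\beta^2$ and $\gamma^2\delta^2$ occur as vertices of such a tiling, then $f>8$, $\beta>\delta\ge\frac{\pi}{2}$, and every vertex of the tiling is one of $\alpha\beta^2$, $\gamma^2\delta^2$, $\alpha^2\delta^2$, or $\gamma^m$ with $m\ge 3$ even. Moreover, no such tiling exists: there is no tiling as above in which both $\alpha\beta^2$ and $\gamma^2\delta^2$ are vertices. -/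

import Mathlib

open Real Set Filter Topology

noncomputable section

/-- Euclidean three-space. -/
abbrev E3 : Type := EuclideanSpace ℝ (Fin 3)

/-- The unit sphere of Euclidean three-space, with its subspace topology. -/
abbrev S2 : Type := Metric.sphere (0 : E3) 1

/-- The point at distance `t` from `v` on the great circle that leaves the point `v` of the unit
sphere in the direction of the unit tangent vector `u`. -/
def geodesic (v u : E3) (t : ℝ) : E3 := cos t • v + sin t • u

/-- The action of an orthogonal transformation on the unit sphere. -/
def sphereMap (g : E3 ≃ₗᵢ[ℝ] E3) (p : S2) : S2 :=
  ⟨g p, by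
    have h : ‖(p : E3)‖ = 1 := norm_eq_of_mem_sphere p
    simp [h]⟩

/-- A simple geodesic quadrilateral `ABCD` on the unit sphere.  The corners `A, B, C, D` have the
indices `0, 1, 2, 3`, and edge number `i` is the great circle arc from corner `i` to corner `i + 1`
(indices modulo `4`).  Edges may be longer than `π` and interior angles may be at least `π`. -/
structure SphericalQuadrilateral where
  /-- the corners -/
  vertex : Fin 4 → S2
  /-- the initial direction, at corner `i`, of the edge from corner `i` to corner `i + 1` -/
  dir : Fin 4 → E3
  /-- the lengths of the edges -/
  len : Fin 4 → ℝ
  /-- the interior angles -/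
  angle : Fin 4 → ℝ
  /-- the unit tangent vector at corner `i`, orthogonal to edge `i`, on the side of the interior -/
  inward : Fin 4 → E3
  /-- the closed region of the sphere that the quadrilateral bounds -/
  region : Set S2
  dir_norm : ∀ i, ‖dir i‖ = 1
  dir_tangent : ∀ i, inner ℝ (vertex i : E3) (dir i) = 0
  len_pos : ∀ i, 0 < len i
  vertex_succ : ∀ i, (vertex (i + 1) : E3) = geodesic (vertex i) (dir i) (len i)
  /-- the boundary is a simple closed curve -/
  simple : ∀ i j, ∀ s ∈ Ico 0 (len i), ∀ t ∈ Ico 0 (len j),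
    geodesic (vertex i) (dir i) s = geodesic (vertex j) (dir j) t → i = j ∧ s = t
  region_closed : IsClosed region
  region_frontier : frontier region =
    ⋃ i, {p : S2 | ∃ t ∈ Icc 0 (len i), (p : E3) = geodesic (vertex i) (dir i) t}
  inward_norm : ∀ i, ‖inward i‖ = 1
  inward_tangent : ∀ i, inner ℝ (vertex i : E3) (inward i) = 0
  inward_orthogonal : ∀ i, inner ℝ (dir i) (inward i) = 0
  angle_pos : ∀ i, 0 < angle i
  angle_lt : ∀ i, angle i < 2 * π
  /-- Turning the direction of edge `i` at corner `i` through the interior angle, towards the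
  interior, gives the direction of edge `i - 1` (traversed backwards) at corner `i`. -/
  angle_turn : ∀ i, cos (angle i) • dir i + sin (angle i) • inward i =
    sin (len (i - 1)) • (vertex (i - 1) : E3) - cos (len (i - 1)) • dir (i - 1)
  /-- All the directions that are passed in this turn point into the interior of the region. -/
  angle_interior : ∀ i, ∀ φ ∈ Ioo 0 (angle i), ∀ᶠ t in 𝓝[>] (0 : ℝ),
    ∃ p ∈ interior region,
      (p : E3) = geodesic (vertex i) (cos φ • dir i + sin φ • inward i) t

namespace SphericalQuadrilateral

variable (Q : SphericalQuadrilateral)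

/-- The edge from corner `i` to corner `i + 1`, with its endpoints. -/
def edge (i : Fin 4) : Set S2 :=
  {p | ∃ t ∈ Icc 0 (Q.len i), (p : E3) = geodesic (Q.vertex i) (Q.dir i) t}

/-- The edge from corner `i` to corner `i + 1`, without its endpoints. -/
def openEdge (i : Fin 4) : Set S2 :=
  {p | ∃ t ∈ Ioo 0 (Q.len i), (p : E3) = geodesic (Q.vertex i) (Q.dir i) t}

/-- The edge combination `a²bc` in the arrangement `AB = DA = a`, `BC = b`, `CD = c`, where
`a, b, c` are distinct. -/
def IsA2BC : Prop :=
  Q.len 3 = Q.len 0 ∧ Q.len 1 ≠ Q.len 0 ∧ Q.len 2 ≠ Q.len 0 ∧ Q.len 1 ≠ Q.len 2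

end SphericalQuadrilateral

/-- An edge-to-edge tiling of the unit sphere by `f` quadrilaterals, all congruent (by orthogonal
transformations, possibly orientation reversing) to the quadrilateral `tile`, in which all the
vertices have degree at least `3`. -/
structure SphericalTiling (f : ℕ) where
  /-- the prototile -/
  tile : SphericalQuadrilateral
  /-- the congruence that carries the prototile to tile number `i` -/
  place : Fin f → (E3 ≃ₗᵢ[ℝ] E3)
  covers : ⋃ i, sphereMap (place i) '' tile.region = univ
  disjoint_interiors : ∀ i k, i ≠ k →
    Disjoint (interior (sphereMap (place i) '' tile.region))
      (interior (sphereMap (place k) '' tile.region))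
  /-- Two edges of tiles coincide or have at most endpoints in common. -/
  edge_to_edge : ∀ i j k l,
    (sphereMap (place i) '' tile.openEdge j ∩ sphereMap (place k) '' tile.edge l).Nonempty →
      sphereMap (place i) '' tile.edge j = sphereMap (place k) '' tile.edge l
  /-- At least three tiles have a corner at each vertex. -/
  degree_ge_three : ∀ i j,
    3 ≤ ∑ l, {k | sphereMap (place k) (tile.vertex l) = sphereMap (place i) (tile.vertex j)}.ncard

namespace SphericalTiling

variable {f : ℕ} (T : SphericalTiling f)

/-- The corner number `j` of tile number `i`. -/
def corner (i : Fin f) (j : Fin 4) : S2 := sphereMap (T.place i) (T.tile.vertex j)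

/-- The angle combination at a point: `![a, b, c, d]` stands for `α^a β^b γ^c δ^d`, that is, `a`
tiles have their corner `A` there, `b` tiles their corner `B`, `c` tiles their corner `C`, and
`d` tiles their corner `D`. -/
def vertexType (p : S2) : Fin 4 → ℕ := fun j => {i | T.corner i j = p}.ncard

/-- The collection of the angle combinations at the vertices of the tiling (the AVC). -/
def avc : Set (Fin 4 → ℕ) := {m | ∃ i j, m = T.vertexType (T.corner i j)}

/-- The interior angle `α` at `A`, between the two edges of length `a`. -/
def α : ℝ := T.tile.angle 0

/-- The interior angle `β` at `B`, between an edge of length `a` and the edge of length `b`. -/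
def β : ℝ := T.tile.angle 1

/-- The interior angle `γ` at `C`, between the edges of lengths `b` and `c`. -/
def γ : ℝ := T.tile.angle 2

/-- The interior angle `δ` at `D`, between the edge of length `c` and an edge of length `a`. -/
def δ : ℝ := T.tile.angle 3

end SphericalTiling

end

/-!
There is no edge-to-edge tiling by congruent quadrilaterals of type `a²bc` with both vertices `αβ²`
and `γ²δ²`; the claims about the other vertices of such a tiling then hold because there is no
tiling to refute them.

*Reduction to flags.* Near a corner, the region of the tile is exactly the sector of the interior
angle (`SphericalQuadrilateral.corner_sector`): a sector that does not meet the frontier is connected,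
hence lies in the interior or in the complement, and a frontier point cannot be surrounded by the
region. Therefore the tiles around a vertex are arranged like disjoint sectors that fill up the circle
of directions. This yields an involution `SphericalTiling.across` on the flags (a tile, an edge of
it, an end of this edge), which passes to the neighbouring tile. It preserves the vertex, the length
of the edge and the common edge itself (`across_flip`). Adding up the angles along a cycle of adjacent
corners gives a multiple of `2π`, and the disjoint sectors add up to at most `2π`; so the angle sum is
`2π` (`angle_sum`) and the corners at a vertex form a single cycle (`mem_of_closed`). The Euler
formula is not needed.

*Geometry of the tile.* The only other metrical input is `len_eq_of_angle_eq`: if `β = δ` and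
`sin γ ≠ 0`, then the reflection that exchanges the two edges at `A` fixes `C`, so that `b = c`. Hence
`β ≠ δ` here.

*Vertices.* The two given vertices mean that `α + 2β = 2π` and `γ + δ = π`. If `α ≥ π`, then each
corner `A` is at a vertex `αβ²` or `αδⁿ` with `n ≥ 4`, and there would be more corners `B` or `D` than
tiles (`alpha_lt_pi`). If `α < π`, then the angle sum, the parity of the numbers of edges of lengths
`b` and `c`, and the impossibility of certain adjacencies show that `B` occurs only at `αβ²` and that
`C` occurs only at `γ²δ²` and `γ^m` (`vertices_B_C`).

*Contradiction.* From a vertex `γ²δ²`, adjacencies are followed until they force two corners `D` at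
this vertex to be adjacent across the edge of length `c` (`no_vertex_CCDD`). Then the two corners `D`
are adjacent across both of their edges and would be the only corners at this vertex.
-/

/-! ### Polar coordinates on the sphere -/

/-- `v, u, n` is an orthonormal basis of Euclidean three-space. It is used as a point `v` of the
sphere together with an orthonormal basis `u, n` of the tangent plane at `v`. -/
structure IsFrame (v u n : E3) : Prop where
  norm_v : ‖v‖ = 1
  norm_u : ‖u‖ = 1
  norm_n : ‖n‖ = 1
  vu : inner ℝ v u = 0
  vn : inner ℝ v n = 0
  un : inner ℝ u n = 0

/-- The tangent vector that makes the angle `φ` with `u`, measured towards `n`. -/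
noncomputable def turn (u n : E3) (φ : ℝ) : E3 := cos φ • u + sin φ • n

lemma geodesic_add (v u : E3) (s t : ℝ) :
    geodesic v u (s + t) = geodesic (geodesic v u s) (cos s • u - sin s • v) t := by
  simp only [geodesic, cos_add, sin_add]
  module

lemma geodesic_zero (v u : E3) : geodesic v u 0 = v := by simp [geodesic]

lemma turn_zero (u n : E3) : turn u n 0 = u := by simp [turn]

lemma turn_add_two_pi (u n : E3) (φ : ℝ) : turn u n (φ + 2 * π) = turn u n φ := by simp [turn]

lemma continuous_geodesic (v u : E3) : Continuous (geodesic v u) := by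
  unfold geodesic; fun_prop

lemma map_geodesic (g : E3 ≃ₗᵢ[ℝ] E3) (v u : E3) (t : ℝ) :
    g (geodesic v u t) = geodesic (g v) (g u) t := by simp [geodesic]

lemma map_turn (g : E3 ≃ₗᵢ[ℝ] E3) (v u : E3) (t : ℝ) :
    g (turn v u t) = turn (g v) (g u) t := by simp [turn]

lemma inner_geodesic {v u : E3} (hv : ‖v‖ = 1) (h : inner ℝ v u = 0) (t : ℝ) :
    inner ℝ v (geodesic v u t) = cos t := by
  simp [geodesic, inner_add_right, inner_smul_right, h, hv]

/-- A great circle arc shorter than a full turn does not meet itself. -/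
lemma geodesic_inj {v u : E3} (hv : ‖v‖ = 1) (hu : ‖u‖ = 1) (h : inner ℝ v u = 0) {s t : ℝ}
    (hs : s ∈ Ico 0 (2 * π)) (ht : t ∈ Ico 0 (2 * π)) (hst : geodesic v u s = geodesic v u t) :
    s = t := by
  have hc : cos s = cos t := by rw [← inner_geodesic hv h s, hst, inner_geodesic hv h t]
  have hsin : sin s = sin t := by
    have := congrArg (inner ℝ u) hst
    simpa [geodesic, inner_add_right, inner_smul_right, real_inner_comm, h, hu] using this
  have := Real.Angle.cos_sin_inj hc hsin
  rw [Real.Angle.angle_eq_iff_two_pi_dvd_sub] at this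
  obtain ⟨k, hk⟩ := this
  obtain ⟨hs0, hs1⟩ := hs
  obtain ⟨ht0, ht1⟩ := ht
  have hp := two_pi_pos
  have h1 : (-1 : ℝ) < k := by
    by_contra hcon
    push Not at hcon
    nlinarith
  have h2 : (k : ℝ) < 1 := by
    by_contra hcon
    push Not at hcon
    nlinarith
  have h3 : -1 < k := by exact_mod_cast h1
  have h4 : k < 1 := by exact_mod_cast h2
  have : k = 0 := by omega
  subst this
  simp at hk
  linarith

lemma exists_angle {x y : ℝ} (h : x ^ 2 + y ^ 2 = 1) :
    ∃ φ ∈ Ico 0 (2 * π), x = cos φ ∧ y = sin φ := by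
  have hn : ‖(⟨x, y⟩ : ℂ)‖ = 1 := by
    rw [Complex.norm_def, Complex.normSq_mk, ← sq, ← sq, h, Real.sqrt_one]
  have hne : (⟨x, y⟩ : ℂ) ≠ 0 := by
    intro h0; rw [h0] at hn; simp at hn
  have hc := Complex.cos_arg hne
  have hs := Complex.sin_arg (⟨x, y⟩ : ℂ)
  rw [hn, div_one] at hc hs
  have h1 := Complex.neg_pi_lt_arg (⟨x, y⟩ : ℂ)
  have h2 := Complex.arg_le_pi (⟨x, y⟩ : ℂ)
  have hp := pi_pos
  by_cases h0 : 0 ≤ Complex.arg (⟨x, y⟩ : ℂ)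
  · exact ⟨_, ⟨h0, by linarith⟩, hc.symm, hs.symm⟩
  · refine ⟨Complex.arg (⟨x, y⟩ : ℂ) + 2 * π, ⟨by linarith, by linarith⟩, ?_, ?_⟩
    · rw [cos_add_two_pi, hc]
    · rw [sin_add_two_pi, hs]

namespace IsFrame

variable {v u n : E3} (h : IsFrame v u n)
include h

lemma expand (x : E3) : x = inner ℝ v x • v + inner ℝ u x • u + inner ℝ n x • n := by
  have ho : Orthonormal ℝ ![v, u, n] := by
    constructor
    · intro i; fin_cases i
      · exact h.norm_v
      · exact h.norm_u
      · exact h.norm_n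
    · have := h.vu
      have := h.vn
      have := h.un
      intro i j hij
      fin_cases i <;> fin_cases j <;> simp_all [real_inner_comm]
  let b := OrthonormalBasis.mk ho (by
    rw [ho.linearIndependent.span_eq_top_of_card_eq_finrank (by simp)])
  have := b.sum_repr' x
  simp only [Fin.sum_univ_three] at this
  simpa [b] using this.symm

lemma map (g : E3 ≃ₗᵢ[ℝ] E3) : IsFrame (g v) (g u) (g n) :=
  ⟨by simp [h.norm_v], by simp [h.norm_u], by simp [h.norm_n], by simp [h.vu], by simp [h.vn],
    by simp [h.un]⟩

lemma inner_v_turn (φ : ℝ) : inner ℝ v (turn u n φ) = 0 := by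
  simp [turn, inner_add_right, inner_smul_right, h.vu, h.vn]

lemma inner_u_turn (φ : ℝ) : inner ℝ u (turn u n φ) = cos φ := by
  simp [turn, inner_add_right, inner_smul_right, h.norm_u, h.un]

lemma inner_n_turn (φ : ℝ) : inner ℝ n (turn u n φ) = sin φ := by
  simp [turn, inner_add_right, inner_smul_right, h.norm_n, real_inner_comm, h.un]

lemma norm_turn (φ : ℝ) : ‖turn u n φ‖ = 1 := by
  have : ‖turn u n φ‖ ^ 2 = 1 := by
    rw [← real_inner_self_eq_norm_sq]
    nth_rw 1 [turn]
    rw [inner_add_left, inner_smul_left, inner_smul_left, h.inner_u_turn, h.inner_n_turn]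
    simp [← sq]
  nlinarith [norm_nonneg (turn u n φ)]

lemma turn_inj {φ ψ : ℝ} (hφ : φ ∈ Ico 0 (2 * π)) (hψ : ψ ∈ Ico 0 (2 * π))
    (he : turn u n φ = turn u n ψ) : φ = ψ :=
  geodesic_inj h.norm_u h.norm_n h.un hφ hψ he

lemma exists_turn {x : E3} (hx : ‖x‖ = 1) (hv : inner ℝ v x = 0) :
    ∃ φ ∈ Ico 0 (2 * π), x = turn u n φ := by
  have e := h.expand x
  rw [hv, zero_smul, zero_add] at e
  have h2 : inner ℝ x x = inner ℝ u x ^ 2 + inner ℝ n x ^ 2 := by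
    nth_rw 1 [e]
    rw [inner_add_left, inner_smul_left, inner_smul_left]
    simp [← sq]
  rw [real_inner_self_eq_norm_sq, hx] at h2
  obtain ⟨φ, hφ, hc, hs⟩ := exists_angle (x := inner ℝ u x) (y := inner ℝ n x) (by rw [← h2]; simp)
  refine ⟨φ, hφ, ?_⟩
  rw [turn, ← hc, ← hs]; exact e

/-- Turning the basis of the tangent plane and reversing its orientation. This is the passage from
one side of a corner to the other. -/
lemma turn_frame (φ : ℝ) : IsFrame v (turn u n φ) (sin φ • u - cos φ • n) where
  norm_v := h.norm_v
  norm_u := h.norm_turn φ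
  norm_n := by
    have := h.norm_turn (φ - π / 2)
    rwa [turn, cos_sub_pi_div_two, sin_sub_pi_div_two, neg_smul, ← sub_eq_add_neg] at this
  vu := h.inner_v_turn φ
  vn := by simp [inner_sub_right, inner_smul_right, h.vu, h.vn]
  un := by
    rw [inner_sub_right, inner_smul_right, inner_smul_right, real_inner_comm, h.inner_u_turn,
      real_inner_comm, h.inner_n_turn]
    ring

lemma geodesic_frame (t : ℝ) : IsFrame (geodesic v u t) (cos t • u - sin t • v) n := by
  have hf : IsFrame n v u := ⟨h.norm_n, h.norm_v, h.norm_u, by rw [real_inner_comm, h.vn],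
    by rw [real_inner_comm, h.un], h.vu⟩
  have ht := hf.turn_frame t
  refine ⟨ht.norm_u, ?_, h.norm_n, ?_, ?_, ?_⟩
  · rw [← ht.norm_n, ← norm_neg]; congr 1; abel
  · have := ht.un
    rw [← neg_eq_zero, ← inner_neg_right] at this
    rw [← this, turn, geodesic]; congr 1; abel
  · rw [real_inner_comm]; exact ht.vu
  · rw [real_inner_comm, ← neg_eq_zero, ← inner_neg_right, ← ht.vn]; congr 1; abel

lemma neg_n : IsFrame v u (-n) :=
  ⟨h.norm_v, h.norm_u, by rw [norm_neg, h.norm_n], h.vu, by rw [inner_neg_right, h.vn, neg_zero],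
    by rw [inner_neg_right, h.un, neg_zero]⟩

lemma norm_geodesic (t : ℝ) : ‖geodesic v u t‖ = 1 := (h.geodesic_frame t).norm_v

/-- The point of the sphere with the polar coordinates `φ, r` about `v`. -/
noncomputable def point (φ r : ℝ) : S2 :=
  ⟨geodesic v (turn u n φ) r, by
    rw [mem_sphere_zero_iff_norm]; exact (h.turn_frame φ).norm_geodesic r⟩

lemma coe_point (φ r : ℝ) : (h.point φ r : E3) = geodesic v (turn u n φ) r := rfl

lemma continuous_point : Continuous fun x : ℝ × ℝ => h.point x.1 x.2 := by
  apply Continuous.subtype_mk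
  unfold geodesic turn
  fun_prop

lemma inner_point (φ r : ℝ) : inner ℝ v (h.point φ r : E3) = cos r :=
  inner_geodesic h.norm_v (h.inner_v_turn φ) r

lemma inner_n_point (φ r : ℝ) : inner ℝ n (h.point φ r : E3) = sin r * sin φ := by
  rw [coe_point, geodesic, inner_add_right, inner_smul_right, inner_smul_right, h.inner_n_turn,
    real_inner_comm, h.vn]
  ring

lemma exists_polar {η : ℝ} (hη : η ≤ π) (x : S2) (hx : cos η < inner ℝ v (x : E3)) (h0 : 0 < η) :
    ∃ φ ∈ Ico 0 (2 * π), ∃ r ∈ Ico 0 η, x = h.point φ r := by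
  have hxn : ‖(x : E3)‖ = 1 := norm_eq_of_mem_sphere x
  have hle : inner ℝ v (x : E3) ≤ 1 := by
    have := real_inner_le_norm v (x : E3); rwa [h.norm_v, hxn, one_mul] at this
  have hge : -1 ≤ inner ℝ v (x : E3) := by linarith [neg_one_le_cos η]
  set r := arccos (inner ℝ v (x : E3)) with hr
  have hcr : cos r = inner ℝ v (x : E3) := cos_arccos hge hle
  have hr0 : 0 ≤ r := arccos_nonneg _
  have hrπ : r ≤ π := arccos_le_pi _
  have hrη : r < η := by
    by_contra hcon
    push Not at hcon
    have := cos_le_cos_of_nonneg_of_le_pi h0.le hrπ hcon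
    linarith
  rcases hr0.eq_or_lt with h00 | h00
  · have hone : inner ℝ v (x : E3) = 1 := by rw [← hcr, ← h00, cos_zero]
    have : v = x := (inner_eq_one_iff_of_norm_eq_one h.norm_v hxn).mp hone
    refine ⟨0, ⟨le_rfl, two_pi_pos⟩, 0, ⟨le_rfl, h0⟩, Subtype.ext ?_⟩
    rw [coe_point, geodesic_zero, this]
  · have hsr : 0 < sin r := sin_pos_of_pos_of_lt_pi h00 (by linarith)
    have e := h.expand (x : E3)
    set w : E3 := (sin r)⁻¹ • ((x : E3) - cos r • v) with hw
    have hvv : inner ℝ v v = (1 : ℝ) := by rw [real_inner_self_eq_norm_sq, h.norm_v]; norm_num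
    have hvw : inner ℝ v w = 0 := by
      rw [hw, inner_smul_right, inner_sub_right, inner_smul_right, hvv, hcr]; simp
    have hww : ‖w‖ = 1 := by
      have h1 : inner ℝ ((x : E3) - cos r • v) ((x : E3) - cos r • v) = sin r ^ 2 := by
        rw [inner_sub_left, inner_sub_right, inner_sub_right, inner_smul_left, inner_smul_right,
          inner_smul_right, inner_smul_left, hvv, real_inner_comm v (x : E3), ← hcr,
          real_inner_self_eq_norm_sq, hxn, sin_sq, conj_trivial]
        ring
      have h2 : ‖w‖ ^ 2 = 1 := by
        rw [← real_inner_self_eq_norm_sq, hw, inner_smul_left, inner_smul_right, h1]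
        simp; field_simp
      nlinarith [norm_nonneg w]
    obtain ⟨φ, hφ, hwφ⟩ := h.exists_turn hww hvw
    refine ⟨φ, hφ, r, ⟨hr0, hrη⟩, Subtype.ext ?_⟩
    rw [coe_point, ← hwφ, geodesic, hw, smul_smul, mul_inv_cancel₀ hsr.ne', one_smul]
    abel

/-- Polar coordinates are unique away from the pole. -/
lemma point_eq {φ ψ r : ℝ} {u' : E3} (hr : r ∈ Ioo 0 π) {s : ℝ} (hs : s ∈ Ico 0 π)
    (hu' : u' = turn u n ψ) (hφ : φ ∈ Ico 0 (2 * π)) (hψ : ψ ∈ Ico 0 (2 * π))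
    (he : (h.point φ r : E3) = geodesic v u' s) : φ = ψ := by
  subst hu'
  have h1 : cos r = cos s := by
    rw [← h.inner_point φ r, he, inner_geodesic h.norm_v (h.inner_v_turn ψ)]
  have h2 : r = s := injOn_cos ⟨hr.1.le, hr.2.le⟩ ⟨hs.1, hs.2.le⟩ h1
  subst h2
  rw [coe_point, geodesic, geodesic, add_right_inj] at he
  have hsr := sin_pos_of_pos_of_lt_pi hr.1 hr.2
  exact h.turn_inj hφ hψ (smul_right_injective _ hsr.ne' he)

/-- A sector at `v` that does not meet the frontier of a closed set is either contained in its
interior or disjoint from it. -/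
lemma sector_dichotomy {R : Set S2} (hR : IsClosed R) {η a b : ℝ}
    (hfr : ∀ φ ∈ Ioo a b, ∀ r ∈ Ioo 0 η, h.point φ r ∉ frontier R) :
    (∀ φ ∈ Ioo a b, ∀ r ∈ Ioo 0 η, h.point φ r ∈ interior R) ∨
      (∀ φ ∈ Ioo a b, ∀ r ∈ Ioo 0 η, h.point φ r ∉ R) := by
  have hc : IsPreconnected ((fun x : ℝ × ℝ => h.point x.1 x.2) '' (Ioo a b ×ˢ Ioo 0 η)) :=
    (isPreconnected_Ioo.prod isPreconnected_Ioo).image _ h.continuous_point.continuousOn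
  have := hc.subset_or_subset isOpen_interior hR.isOpen_compl
    (disjoint_compl_right_iff_subset.mpr interior_subset) (by
      rintro _ ⟨⟨φ, r⟩, ⟨hφ, hr⟩, rfl⟩
      by_contra hcon
      simp only [mem_union, mem_compl_iff, not_or, not_not] at hcon
      exact hfr φ hφ r hr (by rw [hR.frontier_eq]; exact ⟨hcon.2, hcon.1⟩))
  rcases this with h1 | h1
  · exact Or.inl fun φ hφ r hr => h1 ⟨(φ, r), ⟨hφ, hr⟩, rfl⟩
  · exact Or.inr fun φ hφ r hr => h1 ⟨(φ, r), ⟨hφ, hr⟩, rfl⟩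

lemma tendsto_point (φ r : ℝ) (s : Set ℝ) :
    Tendsto (fun ψ => h.point ψ r) (𝓝[s] φ) (𝓝 (h.point φ r)) :=
  ((h.continuous_point.comp (Continuous.prodMk_left r)).tendsto φ).mono_left nhdsWithin_le_nhds

lemma tendsto_point_radius (φ r : ℝ) (s : Set ℝ) :
    Tendsto (fun t => h.point φ t) (𝓝[s] r) (𝓝 (h.point φ r)) :=
  ((h.continuous_point.comp (Continuous.prodMk_right φ)).tendsto r).mono_left nhdsWithin_le_nhds

lemma point_zero (φ : ℝ) : (h.point φ 0 : E3) = v := by rw [coe_point, geodesic_zero]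

/-- If two complementary open sectors at `p` lie in a closed set, then so does a whole
neighbourhood of `p`. -/
lemma mem_interior_of_sectors {R : Set S2} (hR : IsClosed R) {η w : ℝ} (h0 : 0 < η) (hη : η ≤ π)
    (hw : w ∈ Ioo 0 (2 * π)) {p : S2} (hp : (p : E3) = v)
    (h1 : ∀ φ ∈ Ioo 0 w, ∀ r ∈ Ioo 0 η, h.point φ r ∈ R)
    (h2 : ∀ φ ∈ Ioo w (2 * π), ∀ r ∈ Ioo 0 η, h.point φ r ∈ R) : p ∈ interior R := by
  have hall : ∀ φ ∈ Ico 0 (2 * π), ∀ r ∈ Ioo 0 η, h.point φ r ∈ R := by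
    intro φ hφ r hr
    rcases hφ.1.eq_or_lt with e | e
    · subst e
      refine hR.mem_of_tendsto (h.tendsto_point 0 r (Ioi 0)) ?_
      filter_upwards [Ioo_mem_nhdsGT hw.1] with ψ hψ using h1 ψ hψ r hr
    rcases lt_trichotomy φ w with c | c | c
    · exact h1 φ ⟨e, c⟩ r hr
    · subst c
      refine hR.mem_of_tendsto (h.tendsto_point φ r (Ioi φ)) ?_
      filter_upwards [Ioo_mem_nhdsGT hw.2] with ψ hψ using h2 ψ hψ r hr
    · exact h2 φ ⟨c, hφ.2⟩ r hr
  have hpR : p ∈ R := by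
    have := h.tendsto_point_radius 0 0 (Ioi 0)
    rw [show h.point 0 0 = p from Subtype.ext (by rw [h.point_zero, hp])] at this
    refine hR.mem_of_tendsto this ?_
    filter_upwards [Ioo_mem_nhdsGT h0] with r hr using hall 0 ⟨le_rfl, two_pi_pos⟩ r hr
  rw [mem_interior]
  refine ⟨{x : S2 | cos η < inner ℝ v (x : E3)}, ?_, ?_, ?_⟩
  · intro x hx
    obtain ⟨φ, hφ, r, hr, rfl⟩ := h.exists_polar hη x hx h0
    rcases hr.1.eq_or_lt with e | e
    · subst e
      rwa [show h.point φ 0 = p from Subtype.ext (by rw [h.point_zero, hp])]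
    · exact hall φ hφ r ⟨e, hr.2⟩
  · exact isOpen_lt continuous_const (by fun_prop)
  · rw [Set.mem_ofPred_eq, hp, real_inner_self_eq_norm_sq, h.norm_v, ← cos_zero]
    rw [show (cos 0 : ℝ) ^ 2 = cos 0 by simp]
    exact cos_lt_cos_of_nonneg_of_le_pi le_rfl hη h0

end IsFrame

/-- A compact set is at positive distance from a point outside it, with distances measured by the
cosine of the angle. -/
lemma exists_cap_disjoint {K : Set S2} (hK : IsClosed K) {p : S2} (hp : p ∉ K) :
    ∃ η, 0 < η ∧ η ≤ π ∧ ∀ x ∈ K, inner ℝ (p : E3) (x : E3) ≤ cos η := by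
  rcases K.eq_empty_or_nonempty with rfl | hne
  · exact ⟨π, pi_pos, le_rfl, by simp⟩
  · obtain ⟨y, hy, hmax⟩ := hK.isCompact.exists_isMaxOn hne
      (f := fun x : S2 => (inner ℝ (p : E3) (x : E3) : ℝ)) (by fun_prop)
    have hpn : ‖(p : E3)‖ = 1 := norm_eq_of_mem_sphere p
    have hyn : ‖(y : E3)‖ = 1 := norm_eq_of_mem_sphere y
    have hlt : inner ℝ (p : E3) (y : E3) < 1 :=
      (inner_lt_one_iff_real_of_norm_eq_one hpn hyn).mpr fun e => hp (by rwa [Subtype.ext e])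
    have hge : -1 ≤ inner ℝ (p : E3) (y : E3) := by
      have := neg_le_of_abs_le (abs_real_inner_le_norm (p : E3) (y : E3))
      rwa [hpn, hyn, mul_one] at this
    refine ⟨arccos (inner ℝ (p : E3) (y : E3)), arccos_pos.mpr hlt, arccos_le_pi _, fun x hx => ?_⟩
    rw [cos_arccos hge hlt.le]
    exact hmax hx

/-- A point of a great circle that is close to the starting point has a small parameter, as long as
the parameter stays away from the full turns. -/
lemma abs_lt_of_cos_lt {η t : ℝ} (h0 : 0 < η) (ht : |t| ≤ 2 * π - η)
    (h : cos η < cos t) : |t| < η := by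
  by_contra hcon
  push Not at hcon
  rw [← cos_abs t] at h
  rcases le_total |t| π with hπ | hπ
  · have := cos_le_cos_of_nonneg_of_le_pi h0.le hπ hcon
    linarith
  · rw [← cos_two_pi_sub |t|] at h
    have := cos_le_cos_of_nonneg_of_le_pi h0.le (show 2 * π - |t| ≤ π by linarith) (by linarith)
    linarith

/-! ### The boundary of a quadrilateral near its corners and edges -/

namespace IsFrame

variable {v u n : E3} (h : IsFrame v u n)
include h

/-- Near `v`, a great circle arc that starts at `v` is a single ray in polar coordinates. -/
lemma eq_of_point_eq_geodesic {η φ ψ r t : ℝ} {u' : E3} (hη : η ≤ π) (hr : r ∈ Ioo 0 η)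
    (hφ : φ ∈ Ico 0 (2 * π)) (hψ : ψ ∈ Ico 0 (2 * π)) (hu' : u' = turn u n ψ)
    (ht : t ∈ Icc 0 (2 * π - η)) (he : (h.point φ r : E3) = geodesic v u' t) : φ = ψ := by
  have h1 : cos r = cos t := by
    rw [← h.inner_point φ r, he, hu', inner_geodesic h.norm_v (h.inner_v_turn ψ)]
  have h0 : 0 < η := hr.1.trans hr.2
  have h2 : |t| < η := by
    refine abs_lt_of_cos_lt h0 (by rw [abs_of_nonneg ht.1]; exact ht.2) ?_
    rw [← h1]
    exact cos_lt_cos_of_nonneg_of_le_pi hr.1.le hη hr.2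
  rw [abs_of_nonneg ht.1] at h2
  exact h.point_eq ⟨hr.1, hr.2.trans_le hη⟩ ⟨ht.1, h2.trans_le hη⟩ hu' hφ hψ he

lemma point_neg_n (φ r : ℝ) : h.neg_n.point φ r = h.point (2 * π - φ) r := by
  apply Subtype.ext
  rw [coe_point, coe_point]
  congr 1
  simp [turn]

lemma point_mem_cap {η φ r : ℝ} (hη : η ≤ π) (hr : r ∈ Ioo 0 η) :
    cos η < inner ℝ v (h.point φ r : E3) := by
  rw [h.inner_point]
  exact cos_lt_cos_of_nonneg_of_le_pi hr.1.le hη hr.2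

/-- A point near `v` on the positive side of the great circle through `v` in the direction `u` has
its polar angle between `0` and `π`. -/
lemma exists_polar_of_pos {η : ℝ} (hη : η ≤ π) (h0 : 0 < η) (x : S2)
    (hx : cos η < inner ℝ v (x : E3)) (hn : 0 < inner ℝ n (x : E3)) :
    ∃ φ ∈ Ioo 0 π, ∃ r ∈ Ioo 0 η, x = h.point φ r := by
  obtain ⟨φ, hφ, r, hr, rfl⟩ := h.exists_polar hη x hx h0
  rw [h.inner_n_point] at hn
  have hr0 : 0 < r := by
    rcases hr.1.eq_or_lt with e | e
    · rw [← e] at hn; simp at hn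
    · exact e
  have hs := sin_pos_of_pos_of_lt_pi hr0 (hr.2.trans_le hη)
  have hsφ : 0 < sin φ := by
    by_contra hcon
    push Not at hcon
    nlinarith
  refine ⟨φ, ⟨?_, ?_⟩, r, ⟨hr0, hr.2⟩, rfl⟩
  · rcases hφ.1.eq_or_lt with e | e
    · rw [← e] at hsφ; simp at hsφ
    · exact e
  · by_contra hcon
    push Not at hcon
    have := sin_nonneg_of_nonneg_of_le_pi (x := φ - π) (by linarith) (by linarith [hφ.2])
    rw [sin_sub_pi] at this
    linarith

/-- If a sector at the start of an arc lies in the interior of `R`, then so does the half-disc on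
the same side about a point of the arc, provided that it does not meet the frontier of `R`. -/
lemma half_disc_interior {R : Set S2} (hR : IsClosed R) {p u' : E3} (F : IsFrame p u' n)
    {η t w : ℝ} (hη : η ≤ π) (h0 : 0 < η) (ht : t ∈ Ioo 0 π) (hw : 0 < w)
    (hp : p = geodesic v u t)
    (hfr : ∀ φ ∈ Ioo 0 π, ∀ r ∈ Ioo 0 η, F.point φ r ∉ frontier R)
    (hs : ∀ φ ∈ Ioo 0 w, h.point φ t ∈ interior R) :
    ∀ φ ∈ Ioo 0 π, ∀ r ∈ Ioo 0 η, F.point φ r ∈ interior R := by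
  rcases F.sector_dichotomy hR hfr with hd | hd
  · exact hd
  exfalso
  have hlim : Tendsto (fun φ => (inner ℝ p (h.point φ t : E3) : ℝ)) (𝓝[>] 0) (𝓝 1) := by
    have h1 := (continuous_subtype_val.tendsto _).comp (h.tendsto_point 0 t (Ioi 0))
    have h2 : Tendsto (fun x : E3 => (inner ℝ p x : ℝ)) (𝓝 (h.point 0 t : E3)) (𝓝 _) :=
      Continuous.tendsto (by fun_prop) _
    have h3 := h2.comp h1
    rwa [coe_point, turn_zero, ← hp, real_inner_self_eq_norm_sq, F.norm_v, one_pow] at h3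
  have hlt : cos η < 1 := by
    rw [← cos_zero]; exact cos_lt_cos_of_nonneg_of_le_pi le_rfl hη h0
  have hev := (hlim.eventually (lt_mem_nhds hlt)).and
    ((Ioo_mem_nhdsGT hw : Ioo 0 w ∈ 𝓝[>] (0 : ℝ)) : ∀ᶠ φ in 𝓝[>] (0 : ℝ), φ ∈ Ioo 0 w) |>.and
    ((Ioo_mem_nhdsGT pi_pos : Ioo 0 π ∈ 𝓝[>] (0 : ℝ)) : ∀ᶠ φ in 𝓝[>] (0 : ℝ), φ ∈ Ioo 0 π)
  obtain ⟨φ, ⟨h1, h2⟩, h3⟩ := hev.exists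
  obtain ⟨ψ, hψ, r, hr, he⟩ := F.exists_polar_of_pos hη h0 (h.point φ t) h1 (by
    rw [h.inner_n_point]
    exact mul_pos (sin_pos_of_pos_of_lt_pi ht.1 ht.2) (sin_pos_of_pos_of_lt_pi h3.1 h3.2))
  exact hd ψ hψ r hr (he ▸ interior_subset (hs φ h2))

end IsFrame

namespace SphericalQuadrilateral

variable (Q : SphericalQuadrilateral)

/-- The direction at corner `i` of the edge from corner `i` to corner `i - 1`. -/
noncomputable def back (i : Fin 4) : E3 := turn (Q.dir i) (Q.inward i) (Q.angle i)

lemma frame (i : Fin 4) : IsFrame (Q.vertex i : E3) (Q.dir i) (Q.inward i) :=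
  ⟨norm_eq_of_mem_sphere _, Q.dir_norm i, Q.inward_norm i, Q.dir_tangent i, Q.inward_tangent i,
    Q.inward_orthogonal i⟩

lemma vertex_injective : Function.Injective Q.vertex := by
  intro i j hij
  refine (Q.simple i j 0 ⟨le_rfl, Q.len_pos i⟩ 0 ⟨le_rfl, Q.len_pos j⟩ ?_).1
  rw [geodesic_zero, geodesic_zero, hij]

lemma len_lt (i : Fin 4) : Q.len i < 2 * π := by
  by_contra hcon
  push Not at hcon
  have hg : geodesic (Q.vertex i) (Q.dir i) (2 * π) = Q.vertex i := by simp [geodesic]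
  rcases hcon.eq_or_lt with e | e
  · have := Q.vertex_succ i
    rw [← e, hg] at this
    have := Q.vertex_injective (Subtype.ext this)
    exact absurd this (by fin_cases i <;> decide)
  · have := (Q.simple i i 0 ⟨le_rfl, Q.len_pos i⟩ (2 * π) ⟨two_pi_pos.le, e⟩
      (by rw [hg, geodesic_zero])).2
    linarith [two_pi_pos]

lemma angle_mem (i : Fin 4) : Q.angle i ∈ Ioo 0 (2 * π) := ⟨Q.angle_pos i, Q.angle_lt i⟩

lemma geodesic_back (i : Fin 4) (t : ℝ) : geodesic (Q.vertex i) (Q.back i) t =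
    geodesic (Q.vertex (i - 1)) (Q.dir (i - 1)) (Q.len (i - 1) - t) := by
  have h1 := Q.vertex_succ (i - 1)
  rw [sub_add_cancel] at h1
  rw [back, turn, Q.angle_turn i]
  nth_rw 1 [geodesic]
  rw [h1, geodesic, geodesic, cos_sub, sin_sub]
  module

lemma mem_edge_back {i : Fin 4} {p : S2} : p ∈ Q.edge (i - 1) ↔
    ∃ t ∈ Icc 0 (Q.len (i - 1)), (p : E3) = geodesic (Q.vertex i) (Q.back i) t := by
  constructor
  · rintro ⟨t, ht, hp⟩
    exact ⟨Q.len (i - 1) - t, ⟨by linarith [ht.2], by linarith [ht.1]⟩,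
      by rw [geodesic_back, hp]; congr 1; ring⟩
  · rintro ⟨t, ht, hp⟩
    exact ⟨Q.len (i - 1) - t, ⟨by linarith [ht.2], by linarith [ht.1]⟩, by rw [hp, geodesic_back]⟩

lemma isClosed_edge (i : Fin 4) : IsClosed (Q.edge i) := by
  have h1 : IsClosed (geodesic (Q.vertex i) (Q.dir i) '' Icc 0 (Q.len i)) :=
    (isCompact_Icc.image (continuous_geodesic _ _)).isClosed
  convert h1.preimage (continuous_subtype_val (p := fun x => x ∈ Metric.sphere (0 : E3) 1)) using 1
  ext p
  constructor
  · rintro ⟨t, ht, hp⟩; exact ⟨t, ht, hp.symm⟩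
  · rintro ⟨t, ht, hp⟩; exact ⟨t, ht, hp.symm⟩

lemma mem_edge_cases {k : Fin 4} {p : S2} (hp : p ∈ Q.edge k) :
    (∃ t ∈ Ico 0 (Q.len k), (p : E3) = geodesic (Q.vertex k) (Q.dir k) t) ∨
      p = Q.vertex (k + 1) := by
  obtain ⟨t, ht, hp⟩ := hp
  rcases ht.2.eq_or_lt with e | e
  · right; apply Subtype.ext; rw [hp, e, Q.vertex_succ]
  · exact Or.inl ⟨t, ⟨ht.1, e⟩, hp⟩

lemma vertex_mem_edge {i k : Fin 4} (hp : Q.vertex i ∈ Q.edge k) : k = i ∨ k = i - 1 := by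
  rcases Q.mem_edge_cases hp with ⟨t, ht, he⟩ | he
  · left
    refine (Q.simple k i t ht 0 ⟨le_rfl, Q.len_pos i⟩ ?_).1
    rw [geodesic_zero, he]
  · right; rw [Q.vertex_injective he, add_sub_cancel_right]

lemma openEdge_disjoint_edge {i k : Fin 4} {p : S2} (hp : p ∈ Q.openEdge i) (hk : p ∈ Q.edge k) :
    i = k := by
  obtain ⟨s, hs, hp⟩ := hp
  rcases Q.mem_edge_cases hk with ⟨t, ht, he⟩ | he
  · exact (Q.simple i k s ⟨hs.1.le, hs.2⟩ t ht (by rw [← hp, ← he])).1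
  · have := (Q.simple i (k + 1) s ⟨hs.1.le, hs.2⟩ 0 ⟨le_rfl, Q.len_pos _⟩
      (by rw [← hp, geodesic_zero, he])).2
    exact absurd this hs.1.ne'

lemma mem_frontier_iff {p : S2} : p ∈ frontier Q.region ↔ ∃ i, p ∈ Q.edge i := by
  rw [Q.region_frontier, mem_iUnion]; rfl

lemma vertex_mem_frontier (i : Fin 4) : Q.vertex i ∈ frontier Q.region :=
  Q.mem_frontier_iff.mpr ⟨i, 0, ⟨le_rfl, (Q.len_pos i).le⟩, by rw [geodesic_zero]⟩

lemma exists_corner_radius (i : Fin 4) : ∃ η, 0 < η ∧ η ≤ π ∧ ∀ φ ∈ Ioo 0 (2 * π),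
    φ ≠ Q.angle i → ∀ r ∈ Ioo 0 η, (Q.frame i).point φ r ∉ frontier Q.region := by
  obtain ⟨η, h0, hη, hK⟩ := exists_cap_disjoint (K := ⋃ k ∈ {k | k ≠ i ∧ k ≠ i - 1}, Q.edge k)
    ((Set.toFinite {k | k ≠ i ∧ k ≠ i - 1}).isClosed_biUnion fun k _ => Q.isClosed_edge k)
    (p := Q.vertex i) (by
      simp only [mem_iUnion, not_exists]
      intro k hk hp
      rcases Q.vertex_mem_edge hp with e | e
      · exact hk.1 e
      · exact hk.2 e)
  -- The bounds by `2π - len` ensure that a long edge at the corner does not come back into the cap.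
  refine ⟨min η (min (2 * π - Q.len i) (2 * π - Q.len (i - 1))),
    lt_min h0 (lt_min (by linarith [Q.len_lt i]) (by linarith [Q.len_lt (i - 1)])),
    (min_le_left _ _).trans hη, ?_⟩
  set ρ := min η (min (2 * π - Q.len i) (2 * π - Q.len (i - 1))) with hρ
  have hρπ : ρ ≤ π := (min_le_left _ _).trans hη
  have hρ1 : ρ ≤ 2 * π - Q.len i := (min_le_right _ _).trans (min_le_left _ _)
  have hρ2 : ρ ≤ 2 * π - Q.len (i - 1) := (min_le_right _ _).trans (min_le_right _ _)
  intro φ hφ hφa r hr hmem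
  obtain ⟨k, hk⟩ := Q.mem_frontier_iff.mp hmem
  have hφ' : φ ∈ Ico 0 (2 * π) := ⟨hφ.1.le, hφ.2⟩
  by_cases h1 : k = i
  · subst h1
    obtain ⟨t, ht, he⟩ := hk
    have := (Q.frame k).eq_of_point_eq_geodesic hρπ hr hφ' ⟨le_rfl, two_pi_pos⟩
      (turn_zero _ (Q.inward k)).symm ⟨ht.1, by linarith [ht.2]⟩ he
    exact hφ.1.ne' this
  by_cases h2 : k = i - 1
  · subst h2
    obtain ⟨t, ht, he⟩ := Q.mem_edge_back.mp hk
    have := (Q.frame i).eq_of_point_eq_geodesic hρπ hr hφ' ⟨(Q.angle_pos i).le, Q.angle_lt i⟩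
      rfl ⟨ht.1, by linarith [ht.2]⟩ he
    exact hφa this
  · have hle := hK _ (mem_biUnion (show k ∈ {k | k ≠ i ∧ k ≠ i - 1} from ⟨h1, h2⟩) hk)
    have hr' : r ∈ Ioo 0 η := ⟨hr.1, hr.2.trans_le (min_le_left _ _)⟩
    have := (Q.frame i).point_mem_cap (φ := φ) hη hr'
    linarith

/-- Near a corner, the region is the sector of the interior angle. -/
lemma corner_sector (i : Fin 4) : ∃ η, 0 < η ∧ η ≤ π ∧
    (∀ φ ∈ Ioo 0 (Q.angle i), ∀ r ∈ Ioo 0 η, (Q.frame i).point φ r ∈ interior Q.region) ∧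
    (∀ φ ∈ Ioo (Q.angle i) (2 * π), ∀ r ∈ Ioo 0 η, (Q.frame i).point φ r ∉ Q.region) := by
  obtain ⟨η, h0, hη, hfr⟩ := Q.exists_corner_radius i
  obtain ⟨ha0, ha1⟩ := Q.angle_mem i
  have hin : ∀ φ ∈ Ioo 0 (Q.angle i), ∀ r ∈ Ioo 0 η,
      (Q.frame i).point φ r ∈ interior Q.region := by
    rcases (Q.frame i).sector_dichotomy Q.region_closed (η := η) (a := 0) (b := Q.angle i)
      (fun φ hφ r hr => hfr φ ⟨hφ.1, hφ.2.trans ha1⟩ hφ.2.ne r hr) with hd | hd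
    · exact hd
    exfalso
    have hmid : Q.angle i / 2 ∈ Ioo 0 (Q.angle i) := ⟨by linarith, by linarith⟩
    obtain ⟨r, ⟨p, hp, he⟩, hr⟩ := ((Q.angle_interior i _ hmid).and
      (Ioo_mem_nhdsGT h0 : ∀ᶠ r in 𝓝[>] (0 : ℝ), r ∈ Ioo 0 η)).exists
    have : p = (Q.frame i).point (Q.angle i / 2) r := Subtype.ext he
    exact hd _ hmid r hr (this ▸ interior_subset hp)
  refine ⟨η, h0, hη, hin, ?_⟩
  rcases (Q.frame i).sector_dichotomy Q.region_closed (η := η) (a := Q.angle i) (b := 2 * π)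
    (fun φ hφ r hr => hfr φ ⟨ha0.trans hφ.1, hφ.2⟩ hφ.1.ne' r hr) with hd | hd
  · have := (Q.frame i).mem_interior_of_sectors Q.region_closed h0 hη ⟨ha0, ha1⟩ rfl
      (fun φ hφ r hr => interior_subset (hin φ hφ r hr))
      (fun φ hφ r hr => interior_subset (hd φ hφ r hr))
    exact absurd this (Q.vertex_mem_frontier i).2
  · exact hd

/-- The frame at the point of edge `i` at distance `t` from corner `i`: the direction of the edge
and the normal that points inwards at corner `i`. -/
lemma edgeFrame (i : Fin 4) (t : ℝ) : IsFrame (geodesic (Q.vertex i) (Q.dir i) t)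
    (cos t • Q.dir i - sin t • (Q.vertex i : E3)) (Q.inward i) := (Q.frame i).geodesic_frame t

lemma exists_edge_radius (i : Fin 4) {t : ℝ} (ht : t ∈ Ioo 0 (Q.len i)) :
    ∃ η, 0 < η ∧ η ≤ π ∧ ∀ φ ∈ Ioo 0 (2 * π), φ ≠ π → ∀ r ∈ Ioo 0 η,
      (Q.edgeFrame i t).point φ r ∉ frontier Q.region := by
  have hpS : (Q.edgeFrame i t).point 0 0 ∈ Q.openEdge i :=
    ⟨t, ht, by rw [IsFrame.point_zero]⟩
  obtain ⟨η, h0, hη, hK⟩ := exists_cap_disjoint (K := ⋃ k ∈ {k | k ≠ i}, Q.edge k)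
    ((Set.toFinite {k | k ≠ i}).isClosed_biUnion fun k _ => Q.isClosed_edge k)
    (p := (Q.edgeFrame i t).point 0 0) (by
      simp only [mem_iUnion, not_exists]
      intro k hk hp
      exact hk (Q.openEdge_disjoint_edge hpS hp).symm)
  refine ⟨min η (2 * π - Q.len i), lt_min h0 (by linarith [Q.len_lt i]),
    (min_le_left _ _).trans hη, ?_⟩
  set ρ := min η (2 * π - Q.len i) with hρ
  have hρπ : ρ ≤ π := (min_le_left _ _).trans hη
  have hρ1 : ρ ≤ 2 * π - Q.len i := min_le_right _ _
  intro φ hφ hφπ r hr hmem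
  obtain ⟨k, hk⟩ := Q.mem_frontier_iff.mp hmem
  have hφ' : φ ∈ Ico 0 (2 * π) := ⟨hφ.1.le, hφ.2⟩
  by_cases h1 : k = i
  · subst h1
    obtain ⟨s, hs, he⟩ := hk
    rw [show s = t + (s - t) by ring, geodesic_add] at he
    rcases le_total t s with hts | hts
    · have := (Q.edgeFrame k t).eq_of_point_eq_geodesic hρπ hr hφ' ⟨le_rfl, two_pi_pos⟩
        (turn_zero _ (Q.inward k)).symm ⟨by linarith, by linarith [hs.2, ht.1]⟩ he
      exact hφ.1.ne' this
    · have hneg : geodesic (geodesic (Q.vertex k) (Q.dir k) t)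
          (cos t • Q.dir k - sin t • (Q.vertex k : E3)) (s - t) =
          geodesic (geodesic (Q.vertex k) (Q.dir k) t)
          (turn (cos t • Q.dir k - sin t • (Q.vertex k : E3)) (Q.inward k) π) (t - s) := by
        rw [show s - t = -(t - s) by ring]
        simp only [geodesic, turn, cos_neg, sin_neg, cos_pi, sin_pi]
        module
      rw [hneg] at he
      have := (Q.edgeFrame k t).eq_of_point_eq_geodesic hρπ hr hφ'
        ⟨pi_pos.le, by linarith [pi_pos]⟩ rfl ⟨by linarith, by linarith [hs.1, ht.2]⟩ he
      exact hφπ this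
  · have hle := hK _ (mem_biUnion (show k ∈ {k | k ≠ i} from h1) hk)
    have hr' : r ∈ Ioo 0 η := ⟨hr.1, hr.2.trans_le (min_le_left _ _)⟩
    have := (Q.edgeFrame i t).point_mem_cap (φ := φ) hη hr'
    rw [IsFrame.point_zero] at hle
    linarith

/-- The points just off the point at distance `t` on edge `i`, on the side of the normal that points
inwards at corner `i`, are in the interior. -/
def InwardSide (i : Fin 4) (t : ℝ) : Prop :=
  ∀ᶠ s in 𝓝[>] (0 : ℝ), (Q.edgeFrame i t).point (π / 2) s ∈ interior Q.region

lemma inner_edgeFrame_point (i : Fin 4) (t₀ t s : ℝ) :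
    inner ℝ (geodesic (Q.vertex i) (Q.dir i) t₀) ((Q.edgeFrame i t).point (π / 2) s : E3) =
      cos s * cos (t - t₀) := by
  have hF := Q.edgeFrame i t₀
  rw [IsFrame.coe_point, turn, cos_pi_div_two, sin_pi_div_two, zero_smul, zero_add, one_smul]
  nth_rw 2 [geodesic]
  rw [inner_add_right, inner_smul_right, inner_smul_right, hF.vn,
    show t = t₀ + (t - t₀) by ring, geodesic_add, inner_geodesic hF.norm_v hF.vu]
  simp

lemma inwardSide_locally_constant (i : Fin 4) {t₀ : ℝ} (ht₀ : t₀ ∈ Ioo 0 (Q.len i)) :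
    (∀ᶠ t in 𝓝 t₀, Q.InwardSide i t) ∨ (∀ᶠ t in 𝓝 t₀, ¬ Q.InwardSide i t) := by
  obtain ⟨η, h0, hη, hfr⟩ := Q.exists_edge_radius i ht₀
  have hπ := pi_pos
  have key : ∀ t, |t - t₀| < η → ∀ᶠ s in 𝓝[>] (0 : ℝ), ∃ φ ∈ Ioo 0 π, ∃ r ∈ Ioo 0 η,
      (Q.edgeFrame i t).point (π / 2) s = (Q.edgeFrame i t₀).point φ r := by
    intro t ht
    have h1 : cos η < cos 0 * cos (t - t₀) := by
      rw [cos_zero, one_mul, ← cos_abs (t - t₀)]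
      exact cos_lt_cos_of_nonneg_of_le_pi (abs_nonneg _) hη ht
    have h2 : Tendsto (fun s => cos s * cos (t - t₀)) (𝓝[>] 0) (𝓝 (cos 0 * cos (t - t₀))) :=
      (Continuous.tendsto (by fun_prop) 0).mono_left nhdsWithin_le_nhds
    filter_upwards [h2.eventually (lt_mem_nhds h1), Ioo_mem_nhdsGT hπ] with s hs hsπ
    refine (Q.edgeFrame i t₀).exists_polar_of_pos hη h0 _ ?_ ?_
    · rwa [inner_edgeFrame_point]
    · rw [IsFrame.inner_n_point, sin_pi_div_two, mul_one]
      exact sin_pos_of_pos_of_lt_pi hsπ.1 hsπ.2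
  have hnear : ∀ᶠ t in 𝓝 t₀, |t - t₀| < η := by
    filter_upwards [Metric.ball_mem_nhds t₀ h0] with t ht
    rwa [Metric.mem_ball, Real.dist_eq] at ht
  rcases (Q.edgeFrame i t₀).sector_dichotomy Q.region_closed (η := η) (a := 0) (b := π)
    (fun φ hφ r hr => hfr φ ⟨hφ.1, by linarith [hφ.2]⟩ hφ.2.ne r hr) with hd | hd
  · left
    filter_upwards [hnear] with t ht
    filter_upwards [key t ht] with s hs
    obtain ⟨φ, hφ, r, hr, he⟩ := hs
    exact he ▸ hd φ hφ r hr
  · right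
    filter_upwards [hnear] with t ht hin
    obtain ⟨s, ⟨φ, hφ, r, hr, he⟩, hs⟩ := ((key t ht).and hin).exists
    exact hd φ hφ r hr (he ▸ interior_subset hs)

lemma inwardSide_near_start (i : Fin 4) : ∀ᶠ t in 𝓝[>] (0 : ℝ), Q.InwardSide i t := by
  obtain ⟨ρ, hρ0, hρπ, hin, -⟩ := Q.corner_sector i
  filter_upwards [Ioo_mem_nhdsGT hρ0, Ioo_mem_nhdsGT (Q.len_pos i)] with t ht htl
  obtain ⟨η, h0, hη, hfr⟩ := Q.exists_edge_radius i htl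
  have := (Q.frame i).half_disc_interior Q.region_closed (Q.edgeFrame i t) hη h0
    ⟨ht.1, ht.2.trans_le hρπ⟩ (Q.angle_pos i) rfl
    (fun φ hφ r hr => hfr φ ⟨hφ.1, by linarith [hφ.2, pi_pos]⟩ hφ.2.ne r hr)
    (fun φ hφ => hin φ hφ t ht)
  filter_upwards [Ioo_mem_nhdsGT h0] with s hs
  exact this _ ⟨by linarith [pi_pos], by linarith [pi_pos]⟩ s hs

/-- The interior lies on the same side all along an edge. -/
lemma inwardSide_of_mem (i : Fin 4) {t : ℝ} (ht : t ∈ Ioo 0 (Q.len i)) : Q.InwardSide i t := by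
  have hsub := (isPreconnected_Ioo (a := 0) (b := Q.len i)).subset_or_subset
    (u := interior {t | Q.InwardSide i t}) (v := interior {t | ¬ Q.InwardSide i t})
    isOpen_interior isOpen_interior
    ((disjoint_compl_right (a := {t | Q.InwardSide i t})).mono interior_subset interior_subset)
    (fun t ht => by
      rcases Q.inwardSide_locally_constant i ht with h | h
      · exact Or.inl (mem_interior_iff_mem_nhds.mpr h)
      · exact Or.inr (mem_interior_iff_mem_nhds.mpr h))
  rcases hsub with h | h
  · exact (interior_subset (h ht) : t ∈ {t | Q.InwardSide i t})
  · obtain ⟨s, hs, hsl⟩ := ((Q.inwardSide_near_start i).and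
      (Ioo_mem_nhdsGT (Q.len_pos i) : ∀ᶠ r in 𝓝[>] (0 : ℝ), r ∈ Ioo 0 (Q.len i))).exists
    exact absurd hs (interior_subset (h hsl) : s ∈ {t | ¬ Q.InwardSide i t})

/-- The frame at corner `i` that is seen from the edge `i - 1`. -/
lemma backFrame (i : Fin 4) : IsFrame (Q.vertex i : E3) (Q.back i)
    (sin (Q.angle i) • Q.dir i - cos (Q.angle i) • Q.inward i) := (Q.frame i).turn_frame _

lemma turn_back (i : Fin 4) (φ : ℝ) :
    turn (Q.back i) (sin (Q.angle i) • Q.dir i - cos (Q.angle i) • Q.inward i) φ =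
      turn (Q.dir i) (Q.inward i) (Q.angle i - φ) := by
  simp only [back, turn, cos_sub, sin_sub]
  module

lemma backFrame_point (i : Fin 4) (φ r : ℝ) :
    (Q.backFrame i).point φ r = (Q.frame i).point (Q.angle i - φ) r := by
  apply Subtype.ext
  rw [IsFrame.coe_point, IsFrame.coe_point, turn_back]

/-- The inward normals at the two ends of an edge agree. -/
lemma inward_eq (i : Fin 4) : sin (Q.angle (i + 1)) • Q.dir (i + 1) -
    cos (Q.angle (i + 1)) • Q.inward (i + 1) = Q.inward i := by
  set m := sin (Q.angle (i + 1)) • Q.dir (i + 1) - cos (Q.angle (i + 1)) • Q.inward (i + 1) with hm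
  have hB : IsFrame (Q.vertex (i + 1) : E3) (Q.back (i + 1)) m := Q.backFrame (i + 1)
  have hE := Q.edgeFrame i (Q.len i)
  rw [← Q.vertex_succ] at hE
  have hback : Q.back (i + 1) = -(cos (Q.len i) • Q.dir i - sin (Q.len i) • (Q.vertex i : E3)) := by
    have := Q.angle_turn (i + 1)
    rw [add_sub_cancel_right] at this
    rw [back, turn, this]; abel
  have hexp := hE.expand m
  have h1 : inner ℝ (cos (Q.len i) • Q.dir i - sin (Q.len i) • (Q.vertex i : E3)) m = 0 := by
    have := hB.un
    rwa [hback, inner_neg_left, neg_eq_zero] at this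
  rw [hB.vn, h1, zero_smul, zero_smul, zero_add, zero_add] at hexp
  have hnorm : |inner ℝ (Q.inward i) m| = 1 := by
    have h2 := hB.norm_n
    rw [hexp, norm_smul, hE.norm_n, mul_one] at h2
    exact h2
  rcases eq_or_eq_neg_of_abs_eq hnorm with h2 | h2
  · rw [hexp, h2, one_smul]
  exfalso
  rw [h2, neg_one_smul] at hexp
  -- Otherwise both sides of the edge near corner `i + 1` are in the interior.
  have hB' : IsFrame (Q.vertex (i + 1) : E3) (Q.back (i + 1)) (-Q.inward i) := hexp ▸ hB
  have hpt : ∀ φ r, hB'.point φ r = (Q.frame (i + 1)).point (Q.angle (i + 1) - φ) r := by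
    intro φ r
    rw [← Q.backFrame_point]
    apply Subtype.ext
    rw [IsFrame.coe_point, IsFrame.coe_point, ← hm, hexp]
  obtain ⟨ρ, hρ0, hρπ, hin, -⟩ := Q.corner_sector (i + 1)
  obtain ⟨s, hs⟩ : ∃ s, s ∈ Ioo 0 (min ρ (Q.len i)) := nonempty_Ioo.mpr (lt_min hρ0 (Q.len_pos i))
  have hs1 := hs.2.trans_le (min_le_left _ _)
  have hs2 := hs.2.trans_le (min_le_right _ _)
  have htl : Q.len i - s ∈ Ioo 0 (Q.len i) := ⟨by linarith, by linarith [hs.1]⟩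
  obtain ⟨η, h0, hη, hfr⟩ := Q.exists_edge_radius i htl
  have hright := hB'.half_disc_interior Q.region_closed (Q.edgeFrame i (Q.len i - s)).neg_n hη h0
    ⟨hs.1, hs1.trans_le hρπ⟩ (Q.angle_pos (i + 1))
    (by rw [geodesic_back, add_sub_cancel_right])
    (fun φ hφ r hr => by
      rw [IsFrame.point_neg_n]
      exact hfr _ ⟨by linarith [hφ.2, pi_pos], by linarith [hφ.1]⟩ (by linarith [hφ.2]) r hr)
    (fun φ hφ => by
      rw [hpt]; exact hin _ ⟨by linarith [hφ.2], by linarith [hφ.1]⟩ s ⟨hs.1, hs1⟩)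
  have hleft : ∀ φ ∈ Ioo 0 π, ∀ r ∈ Ioo 0 η,
      (Q.edgeFrame i (Q.len i - s)).point φ r ∈ interior Q.region := by
    rcases (Q.edgeFrame i (Q.len i - s)).sector_dichotomy Q.region_closed (η := η) (a := 0) (b := π)
      (fun φ hφ r hr => hfr φ ⟨hφ.1, by linarith [hφ.2, pi_pos]⟩ hφ.2.ne r hr) with hd | hd
    · exact hd
    · obtain ⟨r, hr, hrη⟩ := ((Q.inwardSide_of_mem i htl).and
        (Ioo_mem_nhdsGT h0 : ∀ᶠ r in 𝓝[>] (0 : ℝ), r ∈ Ioo 0 η)).exists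
      exact absurd (interior_subset hr)
        (hd _ ⟨by linarith [pi_pos], by linarith [pi_pos]⟩ r hrη)
  have hint := (Q.edgeFrame i (Q.len i - s)).mem_interior_of_sectors Q.region_closed h0 hη
    (w := π) ⟨pi_pos, by linarith [pi_pos]⟩ (p := (Q.edgeFrame i (Q.len i - s)).point 0 0)
    (IsFrame.point_zero _ _)
    (fun φ hφ r hr => interior_subset (hleft φ hφ r hr))
    (fun φ hφ r hr => by
      have := hright (2 * π - φ) ⟨by linarith [hφ.2], by linarith [hφ.1]⟩ r hr
      rw [(Q.edgeFrame i (Q.len i - s)).point_neg_n, sub_sub_cancel] at this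
      exact interior_subset this)
  refine (Q.mem_frontier_iff.mpr ⟨i, Q.len i - s, ⟨htl.1.le, htl.2.le⟩, ?_⟩ :
    (Q.edgeFrame i (Q.len i - s)).point 0 0 ∈ frontier Q.region).2 hint
  rw [IsFrame.point_zero]

end SphericalQuadrilateral

/-! ### Quadrilaterals with equal angles at `B` and `D` -/

namespace SphericalQuadrilateral

variable (Q : SphericalQuadrilateral)

lemma dir_eq_turn_back (i : Fin 4) : Q.dir (i + 1) =
    turn (Q.back (i + 1)) (Q.inward i) (Q.angle (i + 1)) := by
  rw [← Q.inward_eq i, Q.turn_back, sub_self, turn_zero]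

lemma inward_eq_turn_back (i : Fin 4) : Q.inward (i + 1) =
    sin (Q.angle (i + 1)) • Q.back (i + 1) - cos (Q.angle (i + 1)) • Q.inward i := by
  rw [← Q.inward_eq i, back, turn]
  have h := sin_sq_add_cos_sq (Q.angle (i + 1))
  calc Q.inward (i + 1)
      = (sin (Q.angle (i + 1)) ^ 2 + cos (Q.angle (i + 1)) ^ 2) • Q.inward (i + 1) := by
        rw [h, one_smul]
    _ = _ := by module

/-- The reflection that exchanges the two edges at `A` maps the great circle of `BC` to that of
`DC`, hence fixes their intersection `C`, unless `C` is a straight angle. -/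
lemma len_eq_of_angle_eq (h3 : Q.len 3 = Q.len 0) (hang : Q.angle 1 = Q.angle 3)
    (hγ : sin (Q.angle 2) ≠ 0) : Q.len 1 = Q.len 2 := by
  have hA := Q.frame 0
  have hC := Q.frame 2
  obtain ⟨θ, hθ⟩ : ∃ θ, Q.angle 0 = 2 * θ := ⟨Q.angle 0 / 2, by ring⟩
  obtain ⟨m, hm⟩ : ∃ m, m = sin θ • Q.dir 0 - cos θ • Q.inward 0 := ⟨_, rfl⟩
  have hmA : IsFrame (Q.vertex 0 : E3) (turn (Q.dir 0) (Q.inward 0) θ) m := by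
    rw [hm]; exact hA.turn_frame θ
  set M : E3 ≃ₗᵢ[ℝ] E3 := (Submodule.span ℝ {m})ᗮ.reflection with hM
  have hMx : ∀ x, M x = x - (2 * inner ℝ m x) • m := by
    intro x
    rw [hM, Submodule.reflection_orthogonal_apply, Submodule.reflection_singleton_apply, hmA.norm_n]
    simp
    module
  have hMM : ∀ x, M (M x) = x := fun x => Submodule.reflection_reflection _ x
  have hMA : M (Q.vertex 0) = Q.vertex 0 := by
    rw [hMx, real_inner_comm, hmA.vn]; simp
  have hs := sin_sq_add_cos_sq θ
  have hinn1 : inner ℝ m (Q.dir 0) = sin θ := by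
    rw [hm, inner_sub_left, inner_smul_left, inner_smul_left, real_inner_self_eq_norm_sq,
      hA.norm_u, real_inner_comm, hA.un]
    simp
  have hinn2 : inner ℝ m (Q.inward 0) = -cos θ := by
    rw [hm, inner_sub_left, inner_smul_left, inner_smul_left, real_inner_self_eq_norm_sq,
      hA.norm_n, hA.un]
    simp
  have hMe1 : M (Q.dir 0) = Q.back 0 := by
    rw [hMx, hinn1, back, turn, hθ, cos_two_mul', sin_two_mul, hm]
    calc _ = (1 - 2 * sin θ ^ 2) • Q.dir 0 + (2 * sin θ * cos θ) • Q.inward 0 := by module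
      _ = _ := by rw [show 1 - 2 * sin θ ^ 2 = cos θ ^ 2 - sin θ ^ 2 by linarith]
  have hin3 : Q.inward 3 = sin (Q.angle 0) • Q.dir 0 - cos (Q.angle 0) • Q.inward 0 :=
    (Q.inward_eq 3).symm
  have hMe2 : M (Q.inward 0) = Q.inward 3 := by
    rw [hMx, hinn2, hin3, hθ, cos_two_mul', sin_two_mul, hm]
    calc _ = (2 * sin θ * cos θ) • Q.dir 0 + (1 - 2 * cos θ ^ 2) • Q.inward 0 := by module
      _ = (2 * sin θ * cos θ) • Q.dir 0 + (-(cos θ ^ 2 - sin θ ^ 2)) • Q.inward 0 := by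
        rw [show 1 - 2 * cos θ ^ 2 = -(cos θ ^ 2 - sin θ ^ 2) by linarith]
      _ = _ := by module
  have hB : (Q.vertex 1 : E3) = geodesic (Q.vertex 0) (Q.dir 0) (Q.len 0) := Q.vertex_succ 0
  have hD : geodesic (Q.vertex 0) (Q.back 0) (Q.len 0) = Q.vertex 3 := by
    rw [Q.geodesic_back 0, ← h3]
    change geodesic (Q.vertex 3) (Q.dir 3) (Q.len 3 - Q.len 3) = _
    rw [sub_self, geodesic_zero]
  have hMB : M (Q.vertex 1) = Q.vertex 3 := by rw [hB, map_geodesic, hMA, hMe1, hD]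
  have hb1 : Q.back 1 = sin (Q.len 0) • (Q.vertex 0 : E3) - cos (Q.len 0) • Q.dir 0 :=
    Q.angle_turn 1
  have hd3 : Q.dir 3 = sin (Q.len 0) • (Q.vertex 0 : E3) - cos (Q.len 0) • Q.back 0 := by
    have h0 : Q.back 0 = sin (Q.len 3) • (Q.vertex 3 : E3) - cos (Q.len 3) • Q.dir 3 :=
      Q.angle_turn 0
    have h1 : (Q.vertex 0 : E3) = geodesic (Q.vertex 3) (Q.dir 3) (Q.len 3) := Q.vertex_succ 3
    rw [h0, h1, ← h3, geodesic]
    calc Q.dir 3 = (sin (Q.len 3) ^ 2 + cos (Q.len 3) ^ 2) • Q.dir 3 := by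
          rw [sin_sq_add_cos_sq, one_smul]
      _ = _ := by module
  have hMb1 : M (Q.back 1) = Q.dir 3 := by
    rw [hb1, hd3, map_sub, map_smul, map_smul, hMA, hMe1]
  have hdir1 : Q.dir 1 = turn (Q.back 1) (Q.inward 0) (Q.angle 1) := Q.dir_eq_turn_back 0
  have hinw1 : Q.inward 1 = sin (Q.angle 1) • Q.back 1 - cos (Q.angle 1) • Q.inward 0 :=
    Q.inward_eq_turn_back 0
  have hinw2 : sin (Q.angle 3) • Q.dir 3 - cos (Q.angle 3) • Q.inward 3 = Q.inward 2 :=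
    Q.inward_eq 2
  have hinw12 : sin (Q.angle 2) • Q.dir 2 - cos (Q.angle 2) • Q.inward 2 = Q.inward 1 :=
    Q.inward_eq 1
  have hMN1 : M (Q.inward 1) = Q.inward 2 := by
    rw [hinw1, map_sub, map_smul, map_smul, hMb1, hMe2, hang, hinw2]
  have hMN2 : M (Q.inward 2) = Q.inward 1 := by rw [← hMN1, hMM]
  have hMd1 : M (Q.dir 1) = Q.back 3 := by rw [hdir1, map_turn, hMb1, hMe2, hang]; rfl
  have hCN1 : inner ℝ (Q.inward 1) (Q.vertex 2 : E3) = 0 := by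
    rw [← hinw12, inner_sub_left, inner_smul_left, inner_smul_left, real_inner_comm, hC.vu,
      real_inner_comm, hC.vn]
    simp
  have hCN2 : inner ℝ (Q.inward 2) (Q.vertex 2 : E3) = 0 := by rw [real_inner_comm, hC.vn]
  have hMC2 : inner ℝ (Q.inward 2) (M (Q.vertex 2)) = 0 := by
    rw [← hMN1, M.inner_map_map, hCN1]
  have hMC1 : inner ℝ (Q.inward 1) (M (Q.vertex 2)) = 0 := by
    rw [← hMN2, M.inner_map_map, hCN2]
  have hMCd : inner ℝ (Q.dir 2) (M (Q.vertex 2)) = 0 := by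
    rw [← hinw12, inner_sub_left, inner_smul_left, inner_smul_left, hMC2] at hMC1
    simp only [conj_trivial, mul_zero, sub_zero, mul_eq_zero] at hMC1
    exact hMC1.resolve_left hγ
  have hMC : M (Q.vertex 2) = Q.vertex 2 := by
    have hexp := hC.expand (M (Q.vertex 2))
    rw [hMCd, hMC2, zero_smul, zero_smul, add_zero, add_zero] at hexp
    set lam : ℝ := inner ℝ (Q.vertex 2 : E3) (M (Q.vertex 2)) with hlam
    by_cases hmC : inner ℝ m (Q.vertex 2 : E3) = 0
    · rw [hMx, hmC]; simp
    exfalso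
    -- Otherwise the axis of the reflection is the direction of `C`, so that the reflection fixes
    -- the normals of `BC` and `CD`.
    have h1 : (1 - lam) • (Q.vertex 2 : E3) = (2 * inner ℝ m (Q.vertex 2 : E3)) • m := by
      rw [sub_smul, one_smul, ← hexp, hMx]; abel
    have h2 : inner ℝ m (Q.inward 2) = 0 := by
      have h3 := congrArg (inner ℝ (Q.inward 2)) h1
      rw [inner_smul_right, inner_smul_right, hCN2, mul_zero] at h3
      rw [real_inner_comm]
      rcases mul_eq_zero.mp h3.symm with h4 | h4
      · exact absurd (by linarith) hmC
      · exact h4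
    have h3 : Q.inward 1 = Q.inward 2 := by rw [← hMN2, hMx, h2]; simp
    rw [h3] at hinw12
    have h4 := congrArg (inner ℝ (Q.dir 2)) hinw12
    rw [inner_sub_right, inner_smul_right, inner_smul_right, hC.un, real_inner_self_eq_norm_sq,
      hC.norm_u] at h4
    exact hγ (by linarith)
  have hCb : (Q.vertex 2 : E3) = geodesic (Q.vertex 1) (Q.dir 1) (Q.len 1) := Q.vertex_succ 1
  have hC1 : (Q.vertex 2 : E3) = geodesic (Q.vertex 3) (Q.back 3) (Q.len 1) := by
    rw [← hMB, ← hMd1, ← map_geodesic, ← hCb, hMC]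
  have hC2 : (Q.vertex 2 : E3) = geodesic (Q.vertex 3) (Q.back 3) (Q.len 2) := by
    rw [Q.geodesic_back 3]
    change _ = geodesic (Q.vertex 2) (Q.dir 2) (Q.len 2 - Q.len 2)
    rw [sub_self, geodesic_zero]
  have hF := Q.backFrame 3
  exact geodesic_inj hF.norm_v hF.norm_u hF.vu ⟨(Q.len_pos 1).le, Q.len_lt 1⟩
    ⟨(Q.len_pos 2).le, Q.len_lt 2⟩ (hC1.symm.trans hC2)

end SphericalQuadrilateral

/-! ### Flags of a tiling -/

lemma coe_sphereMap (g : E3 ≃ₗᵢ[ℝ] E3) (p : S2) : (sphereMap g p : E3) = g p := rfl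

/-- The action of an orthogonal transformation on the sphere, as a homeomorphism. -/
noncomputable def sphereHomeo (g : E3 ≃ₗᵢ[ℝ] E3) : S2 ≃ₜ S2 where
  toFun := sphereMap g
  invFun := sphereMap g.symm
  left_inv p := Subtype.ext (by simp [coe_sphereMap])
  right_inv p := Subtype.ext (by simp [coe_sphereMap])
  continuous_toFun := (g.continuous.comp continuous_subtype_val).subtype_mk _
  continuous_invFun := (g.symm.continuous.comp continuous_subtype_val).subtype_mk _

lemma interior_sphereMap_image (g : E3 ≃ₗᵢ[ℝ] E3) (A : Set S2) :
    interior (sphereMap g '' A) = sphereMap g '' interior A :=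
  ((sphereHomeo g).image_interior A).symm

lemma sphereMap_injective (g : E3 ≃ₗᵢ[ℝ] E3) : Function.Injective (sphereMap g) :=
  (sphereHomeo g).injective

lemma isClosed_sphereMap_image (g : E3 ≃ₗᵢ[ℝ] E3) {A : Set S2} (hA : IsClosed A) :
    IsClosed (sphereMap g '' A) :=
  (sphereHomeo g).isClosedMap _ hA

lemma IsFrame.sphereMap_point {v u n : E3} (h : IsFrame v u n) (g : E3 ≃ₗᵢ[ℝ] E3) (φ r : ℝ) :
    sphereMap g (h.point φ r) = (h.map g).point φ r := by
  apply Subtype.ext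
  rw [coe_sphereMap, IsFrame.coe_point, IsFrame.coe_point, map_geodesic, map_turn]

namespace SphericalQuadrilateral

variable (Q : SphericalQuadrilateral)

lemma openEdge_subset_edge (i : Fin 4) : Q.openEdge i ⊆ Q.edge i := by
  rintro p ⟨t, ht, hp⟩
  exact ⟨t, ⟨ht.1.le, ht.2.le⟩, hp⟩

lemma edge_cases {i : Fin 4} {p : S2} (hp : p ∈ Q.edge i) :
    p ∈ Q.openEdge i ∨ p = Q.vertex i ∨ p = Q.vertex (i + 1) := by
  rcases Q.mem_edge_cases hp with ⟨t, ht, he⟩ | h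
  · rcases ht.1.eq_or_lt with e | e
    · right; left; apply Subtype.ext; rw [he, ← e, geodesic_zero]
    · exact Or.inl ⟨t, ⟨e, ht.2⟩, he⟩
  · exact Or.inr (Or.inr h)

lemma edge_injective : Function.Injective Q.edge := by
  intro i k h
  have hm : (Q.edgeFrame i (Q.len i / 2)).point 0 0 ∈ Q.openEdge i :=
    ⟨Q.len i / 2, ⟨by linarith [Q.len_pos i], by linarith [Q.len_pos i]⟩, IsFrame.point_zero _ _⟩
  exact Q.openEdge_disjoint_edge hm (h ▸ Q.openEdge_subset_edge i hm)

end SphericalQuadrilateral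

/-- A flag of a tiling by quadrilaterals: a tile, one of its edges, and an end of this edge. The
flag `(i, j, s)` is at corner `j` of tile `i` if `s` is false and at corner `j + 1` if `s` is true;
in both cases it belongs to the edge number `j`. Each corner has two flags, one for each side. -/
abbrev TileFlag (f : ℕ) : Type := Fin f × Fin 4 × Bool

namespace TileFlag

variable {f : ℕ}

/-- The number of the corner of the flag. -/
def idx : TileFlag f → Fin 4
  | (_, j, false) => j
  | (_, j, true) => j + 1

/-- The flag at the other end of the edge. -/
def flip : TileFlag f → TileFlag f
  | (i, j, s) => (i, j, !s)

/-- The flag at the other side of the corner. -/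
def opp : TileFlag f → TileFlag f
  | (i, j, false) => (i, j - 1, true)
  | (i, j, true) => (i, j + 1, false)

lemma opp_opp (x : TileFlag f) : x.opp.opp = x := by
  rcases x with ⟨i, j, _ | _⟩ <;> simp [opp]

lemma opp_fst (x : TileFlag f) : x.opp.1 = x.1 := by
  rcases x with ⟨i, j, _ | _⟩ <;> rfl

lemma flip_fst (x : TileFlag f) : x.flip.1 = x.1 := rfl

lemma idx_opp (x : TileFlag f) : x.opp.idx = x.idx := by
  rcases x with ⟨i, j, _ | _⟩ <;> simp [opp, idx]

lemma opp_edge_ne (x : TileFlag f) : x.opp.2.1 ≠ x.2.1 := by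
  rcases x with ⟨i, j, _ | _⟩ <;> fin_cases j <;> simp [opp]

/-- A corner has only two flags. -/
lemma eq_or_eq_opp {x y : TileFlag f} (h : x.1 = y.1) (hi : x.idx = y.idx) : y = x ∨ y = x.opp := by
  rcases x with ⟨i, j, _ | _⟩ <;> rcases y with ⟨i', j', _ | _⟩ <;>
    simp only [idx] at hi h <;> subst h <;> simp_all [opp]

end TileFlag

namespace SphericalTiling

variable {f : ℕ} (T : SphericalTiling f)

/-- The point of the sphere at which the flag is located. -/
noncomputable def pt (x : TileFlag f) : S2 := T.corner x.1 x.idx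

/-- The interior angle of the corner of the flag. -/
noncomputable def width (x : TileFlag f) : ℝ := T.tile.angle x.idx

/-- The length of the edge of the flag. -/
noncomputable def flagLen (x : TileFlag f) : ℝ := T.tile.len x.2.1

/-- The direction of the edge of the flag at the point of the flag. -/
noncomputable def dirv : TileFlag f → E3
  | (i, j, false) => T.place i (T.tile.dir j)
  | (i, j, true) => T.place i (T.tile.back (j + 1))

/-- The unit normal of the edge of the flag, on the side of the tile. -/
noncomputable def nor : TileFlag f → E3
  | (i, j, false) => T.place i (T.tile.inward j)
  | (i, j, true) => T.place i (sin (T.tile.angle (j + 1)) • T.tile.dir (j + 1) -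
      cos (T.tile.angle (j + 1)) • T.tile.inward (j + 1))

/-- The region that is covered by a tile. -/
def tileRegion (i : Fin f) : Set S2 := sphereMap (T.place i) '' T.tile.region

/-- The edge of the flag. -/
def flagEdge (x : TileFlag f) : Set S2 := sphereMap (T.place x.1) '' T.tile.edge x.2.1

lemma frame (x : TileFlag f) : IsFrame (T.pt x : E3) (T.dirv x) (T.nor x) := by
  rcases x with ⟨i, j, _ | _⟩
  · exact (T.tile.frame j).map (T.place i)
  · exact (T.tile.backFrame (j + 1)).map (T.place i)

lemma width_mem (x : TileFlag f) : T.width x ∈ Ioo 0 (2 * π) := T.tile.angle_mem _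

lemma pt_opp (x : TileFlag f) : T.pt x.opp = T.pt x := by rw [pt, pt, TileFlag.opp_fst, TileFlag.idx_opp]

lemma nor_opp (x : TileFlag f) : T.nor x.opp =
    sin (T.width x) • T.dirv x - cos (T.width x) • T.nor x := by
  rcases x with ⟨i, j, _ | _⟩
  · simp [TileFlag.opp, nor, dirv, width, TileFlag.idx]
  · simp only [TileFlag.opp, nor, dirv, width, TileFlag.idx]
    rw [← map_smul, ← map_smul, ← map_sub]
    congr 1
    have hs := sin_sq_add_cos_sq (T.tile.angle (j + 1))
    rw [SphericalQuadrilateral.back, turn]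
    calc _ = (sin (T.tile.angle (j + 1)) ^ 2 + cos (T.tile.angle (j + 1)) ^ 2) •
          T.tile.inward (j + 1) := by rw [hs, one_smul]
      _ = _ := by module

lemma dirv_opp (x : TileFlag f) : T.dirv x.opp = turn (T.dirv x) (T.nor x) (T.width x) := by
  rcases x with ⟨i, j, _ | _⟩
  · simp [TileFlag.opp, nor, dirv, width, TileFlag.idx, SphericalQuadrilateral.back, map_turn]
  · simp only [TileFlag.opp, nor, dirv, width, TileFlag.idx]
    rw [← map_turn, T.tile.turn_back, sub_self, turn_zero]

lemma frame_point_false (i : Fin f) (j : Fin 4) (φ r : ℝ) :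
    (T.frame (i, j, false)).point φ r = sphereMap (T.place i) ((T.tile.frame j).point φ r) := by
  rw [IsFrame.sphereMap_point]; rfl

lemma frame_point_true (i : Fin f) (j : Fin 4) (φ r : ℝ) :
    (T.frame (i, j, true)).point φ r =
      sphereMap (T.place i) ((T.tile.frame (j + 1)).point (T.tile.angle (j + 1) - φ) r) := by
  rw [← SphericalQuadrilateral.backFrame_point, IsFrame.sphereMap_point]; rfl

lemma eventually_mem_interior (x : TileFlag f) {φ : ℝ} (hφ : φ ∈ Ioo 0 (T.width x)) :
    ∀ᶠ r in 𝓝[>] (0 : ℝ), (T.frame x).point φ r ∈ interior (T.tileRegion x.1) := by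
  obtain ⟨η, h0, -, hin, -⟩ := T.tile.corner_sector x.idx
  filter_upwards [Ioo_mem_nhdsGT h0] with r hr
  rw [tileRegion, interior_sphereMap_image]
  rcases x with ⟨i, j, _ | _⟩
  · exact ⟨_, hin φ hφ r hr, (T.frame_point_false i j φ r).symm⟩
  · exact ⟨_, hin _ ⟨sub_pos.mpr hφ.2, sub_lt_self _ hφ.1⟩ r hr, (T.frame_point_true i j φ r).symm⟩

lemma eventually_not_mem (x : TileFlag f) {φ : ℝ} (hφ : φ ∈ Ioo (T.width x) (2 * π)) :
    ∀ᶠ r in 𝓝[>] (0 : ℝ), (T.frame x).point φ r ∉ T.tileRegion x.1 := by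
  obtain ⟨η, h0, -, -, hout⟩ := T.tile.corner_sector x.idx
  filter_upwards [Ioo_mem_nhdsGT h0] with r hr
  rcases x with ⟨i, j, _ | _⟩
  · rw [frame_point_false, tileRegion, (sphereMap_injective _).mem_set_image]
    exact hout φ hφ r hr
  · rw [frame_point_true, tileRegion, (sphereMap_injective _).mem_set_image]
    have h2 : (T.tile.frame (j + 1)).point (T.tile.angle (j + 1) - φ) r =
        (T.tile.frame (j + 1)).point (T.tile.angle (j + 1) - φ + 2 * π) r := by
      apply Subtype.ext
      rw [IsFrame.coe_point, IsFrame.coe_point, turn_add_two_pi]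
    rw [h2]
    have h3 : T.width (i, j, true) = T.tile.angle (j + 1) := rfl
    have h4 := T.tile.angle_pos (j + 1)
    rw [h3] at hφ
    exact hout _ ⟨by change T.tile.angle (j + 1) < _; linarith [hφ.2], by linarith [hφ.1]⟩ r hr

/-- Sectors of different tiles at a common point have no direction in common. -/
lemma turn_ne_turn {x y : TileFlag f} (hp : T.pt x = T.pt y) (hne : x.1 ≠ y.1) {φ ψ : ℝ}
    (hφ : φ ∈ Ioo 0 (T.width x)) (hψ : ψ ∈ Ioo 0 (T.width y)) :
    turn (T.dirv x) (T.nor x) φ ≠ turn (T.dirv y) (T.nor y) ψ := by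
  intro he
  obtain ⟨r, h1, h2⟩ := ((T.eventually_mem_interior x hφ).and
    (T.eventually_mem_interior y hψ)).exists
  have : (T.frame x).point φ r = (T.frame y).point ψ r := by
    apply Subtype.ext
    rw [IsFrame.coe_point, IsFrame.coe_point, he, hp]
  exact (T.disjoint_interiors x.1 y.1 hne).ne_of_mem h1 h2 this

lemma corner_injective (i : Fin f) : Function.Injective (T.corner i) :=
  (sphereMap_injective _).comp T.tile.vertex_injective

lemma eq_or_eq_opp {x y : TileFlag f} (hp : T.pt x = T.pt y) (ht : x.1 = y.1) : y = x ∨ y = x.opp := by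
  refine TileFlag.eq_or_eq_opp ht (T.corner_injective x.1 ?_)
  rw [pt, pt, ← ht] at hp
  exact hp

lemma mem_flagEdge_iff {x : TileFlag f} {p : S2} : p ∈ T.flagEdge x ↔
    ∃ t ∈ Icc 0 (T.flagLen x), (p : E3) = geodesic (T.pt x) (T.dirv x) t := by
  have key : ∀ j : Fin 4, ∀ q : S2, q ∈ T.tile.edge j ↔ ∃ t ∈ Icc 0 (T.tile.len j),
      (q : E3) = geodesic (T.tile.vertex (j + 1)) (T.tile.back (j + 1)) t := by
    intro j q
    have := T.tile.mem_edge_back (i := j + 1) (p := q)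
    rwa [add_sub_cancel_right] at this
  have hinj : ∀ (i : Fin f) (q : S2) (v u : E3) (t : ℝ), (q : E3) = geodesic v u t ↔
      (sphereMap (T.place i) q : E3) = geodesic (T.place i v) (T.place i u) t := by
    intro i q v u t
    rw [← map_geodesic, coe_sphereMap, (T.place i).injective.eq_iff]
  rcases x with ⟨i, j, _ | _⟩
  · constructor
    · rintro ⟨q, ⟨t, ht, hq⟩, rfl⟩
      exact ⟨t, ht, (hinj _ _ _ _ _).mp hq⟩
    · rintro ⟨t, ht, hp⟩
      obtain ⟨q, rfl⟩ := (sphereHomeo (T.place i)).surjective p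
      exact ⟨q, ⟨t, ht, (hinj _ _ _ _ _).mpr hp⟩, rfl⟩
  · constructor
    · rintro ⟨q, hq, rfl⟩
      obtain ⟨t, ht, hq⟩ := (key j q).mp hq
      exact ⟨t, ht, (hinj _ _ _ _ _).mp hq⟩
    · rintro ⟨t, ht, hp⟩
      obtain ⟨q, rfl⟩ := (sphereHomeo (T.place i)).surjective p
      exact ⟨q, (key j q).mpr ⟨t, ht, (hinj _ _ _ _ _).mpr hp⟩, rfl⟩

lemma flagEdge_flip (x : TileFlag f) : T.flagEdge x.flip = T.flagEdge x := rfl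

lemma pt_mem_flagEdge (x : TileFlag f) : T.pt x ∈ T.flagEdge x :=
  T.mem_flagEdge_iff.mpr ⟨0, ⟨le_rfl, (T.tile.len_pos _).le⟩, by rw [geodesic_zero]⟩

lemma flagLen_lt (x : TileFlag f) : T.flagLen x < 2 * π := T.tile.len_lt _

lemma flagLen_pos (x : TileFlag f) : 0 < T.flagLen x := T.tile.len_pos _

lemma coe_pt_flip (x : TileFlag f) :
    (T.pt x.flip : E3) = geodesic (T.pt x) (T.dirv x) (T.flagLen x) := by
  rcases x with ⟨i, j, _ | _⟩
  · change T.place i (T.tile.vertex (j + 1)) = geodesic (T.place i (T.tile.vertex j))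
      (T.place i _) (T.tile.len j)
    rw [← map_geodesic, ← T.tile.vertex_succ]
  · change T.place i (T.tile.vertex j) = geodesic (T.place i (T.tile.vertex (j + 1)))
      (T.place i _) (T.tile.len j)
    rw [← map_geodesic, T.tile.geodesic_back, add_sub_cancel_right, sub_self, geodesic_zero]

lemma dirv_flip (x : TileFlag f) : T.dirv x.flip =
    sin (T.flagLen x) • (T.pt x : E3) - cos (T.flagLen x) • T.dirv x := by
  have hb : ∀ j, T.tile.back (j + 1) = sin (T.tile.len j) • (T.tile.vertex j : E3) -
      cos (T.tile.len j) • T.tile.dir j := by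
    intro j
    have := T.tile.angle_turn (j + 1)
    rwa [add_sub_cancel_right] at this
  rcases x with ⟨i, j, _ | _⟩
  · change T.place i (T.tile.back (j + 1)) = sin (T.tile.len j) • T.place i (T.tile.vertex j) -
      cos (T.tile.len j) • T.place i _
    rw [hb, map_sub, map_smul, map_smul]
  · change T.place i (T.tile.dir j) = sin (T.tile.len j) • T.place i (T.tile.vertex (j + 1)) -
      cos (T.tile.len j) • T.place i (T.tile.back (j + 1))
    rw [← map_smul, ← map_smul, ← map_sub, hb, T.tile.vertex_succ, geodesic]
    congr 1
    calc T.tile.dir j = (sin (T.tile.len j) ^ 2 + cos (T.tile.len j) ^ 2) • T.tile.dir j := by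
          rw [sin_sq_add_cos_sq, one_smul]
      _ = _ := by module

/-- A point that is a corner of one tile is a corner of every tile that contains it. -/
lemma exists_flag_of_pt_mem (x : TileFlag f) {k : Fin f} (hk : T.pt x ∈ T.tileRegion k) :
    ∃ y : TileFlag f, y.1 = k ∧ T.pt y = T.pt x := by
  suffices h : ∃ j, T.corner k j = T.pt x by
    obtain ⟨j, hj⟩ := h
    exact ⟨(k, j, false), rfl, hj⟩
  obtain ⟨q, hq, hqx⟩ := hk
  have hlim : Tendsto (fun r => (T.frame x).point (T.width x / 2) r) (𝓝[>] 0) (𝓝 (T.pt x)) := by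
    have := (T.frame x).tendsto_point_radius (T.width x / 2) 0 (Ioi 0)
    rwa [show (T.frame x).point (T.width x / 2) 0 = T.pt x from
      Subtype.ext (IsFrame.point_zero _ _)] at this
  have hw := T.width_mem x
  have hev := T.eventually_mem_interior x (φ := T.width x / 2)
    ⟨by linarith [hw.1], by linarith [hw.1]⟩
  by_cases hint : q ∈ interior T.tile.region
  · exfalso
    have hpi : T.pt x ∈ interior (T.tileRegion k) := by
      rw [tileRegion, interior_sphereMap_image]; exact ⟨q, hint, hqx⟩
    by_cases hxk : x.1 = k
    · subst hxk
      rw [← hqx] at hpi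
      rw [tileRegion, interior_sphereMap_image, (sphereMap_injective _).mem_set_image] at hpi
      have : q = T.tile.vertex x.idx := sphereMap_injective (T.place x.1) hqx
      rw [this] at hpi
      exact (T.tile.vertex_mem_frontier x.idx).2 hpi
    · obtain ⟨r, h1, h2⟩ := (hev.and (hlim.eventually (isOpen_interior.mem_nhds hpi))).exists
      exact (T.disjoint_interiors x.1 k hxk).ne_of_mem h1 h2 rfl
  · obtain ⟨l, hl⟩ := T.tile.mem_frontier_iff.mp ⟨subset_closure hq, hint⟩
    rcases T.tile.edge_cases hl with h | h | h
    · exfalso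
      have h1 : ∀ y : TileFlag f, y.1 = x.1 → T.pt y = T.pt x →
          sphereMap (T.place k) '' T.tile.edge l = sphereMap (T.place x.1) '' T.tile.edge y.2.1 := by
        intro y hy hpy
        have hm := T.pt_mem_flagEdge y
        rw [flagEdge, hy, hpy] at hm
        exact T.edge_to_edge k l x.1 y.2.1 ⟨T.pt x, ⟨q, h, hqx⟩, hm⟩
      have h2 := (h1 x.opp x.opp_fst (T.pt_opp x)).symm.trans (h1 x rfl rfl)
      exact x.opp_edge_ne (T.tile.edge_injective ((sphereMap_injective _).image_injective h2))
    · exact ⟨l, by rw [← hqx, h]; rfl⟩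
    · exact ⟨l + 1, by rw [← hqx, h]; rfl⟩

end SphericalTiling

/-! ### The arrangement of the tiles around a vertex -/

namespace IsFrame

variable {v u n : E3} (h : IsFrame v u n)
include h

lemma eq_or_eq_neg_of_same {n' : E3} (h' : IsFrame v u n') : n' = n ∨ n' = -n := by
  have hexp := h.expand n'
  rw [h'.vn, h'.un, zero_smul, zero_smul, zero_add, zero_add] at hexp
  have h2 := h'.norm_n
  rw [hexp, norm_smul, h.norm_n, mul_one] at h2
  rcases eq_or_eq_neg_of_abs_eq h2 with e | e
  · left; rw [hexp, e, one_smul]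
  · right; rw [hexp, e, neg_one_smul]

/-- Two orthonormal bases of the same tangent plane differ by a rotation or a reflection. -/
lemma exists_rotation {u' n' : E3} (h' : IsFrame v u' n') : ∃ θ ∈ Ico 0 (2 * π), u' = turn u n θ ∧
    ∃ e : ℝ, (e = 1 ∨ e = -1) ∧ ∀ φ, turn u' n' φ = turn u n (θ + e * φ) := by
  obtain ⟨θ, hθ, rfl⟩ := h.exists_turn h'.norm_u h'.vu
  refine ⟨θ, hθ, rfl, ?_⟩
  rcases (h.turn_frame θ).eq_or_eq_neg_of_same h' with e | e
  · refine ⟨-1, Or.inr rfl, fun φ => ?_⟩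
    rw [e]
    simp only [turn, neg_mul, one_mul, cos_add, sin_add, cos_neg, sin_neg]
    module
  · refine ⟨1, Or.inl rfl, fun φ => ?_⟩
    rw [e]
    simp only [turn, one_mul, cos_add, sin_add]
    module

end IsFrame

namespace SphericalTiling

variable {f : ℕ} (T : SphericalTiling f)

lemma nor_eq_neg {x y : TileFlag f} (hp : T.pt x = T.pt y) (hd : T.dirv x = T.dirv y)
    (hne : x.1 ≠ y.1) : T.nor y = -T.nor x := by
  have hy := T.frame y
  rw [← hp, ← hd] at hy
  rcases (T.frame x).eq_or_eq_neg_of_same hy with h | h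
  · exfalso
    have hx0 := (T.width_mem x).1
    have hy0 := (T.width_mem y).1
    have hm := lt_min hx0 hy0
    refine T.turn_ne_turn hp hne (φ := min (T.width x) (T.width y) / 2)
      (ψ := min (T.width x) (T.width y) / 2)
      ⟨by linarith, by linarith [min_le_left (T.width x) (T.width y)]⟩
      ⟨by linarith, by linarith [min_le_right (T.width x) (T.width y)]⟩ ?_
    rw [hd, h]
  · exact h

/-- Directions outside the sector of a flag are covered by the closed sectors of other flags. -/
lemma exists_flag_of_direction (x : TileFlag f) {φ : ℝ} (hφ : φ ∈ Ioo (T.width x) (2 * π)) :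
    ∃ y : TileFlag f, y.1 ≠ x.1 ∧ T.pt y = T.pt x ∧ ∃ ψ ∈ Icc 0 (T.width y),
      turn (T.dirv x) (T.nor x) φ = turn (T.dirv y) (T.nor y) ψ := by
  have hfreq : ∃ k, ∃ᶠ r in 𝓝[>] (0 : ℝ), (T.frame x).point φ r ∈ T.tileRegion k := by
    by_contra hcon
    push Not at hcon
    obtain ⟨r, hr⟩ := (eventually_all.mpr hcon).exists
    have := T.covers ▸ mem_univ ((T.frame x).point φ r)
    obtain ⟨k, hk⟩ := mem_iUnion.mp this
    exact hr k hk
  obtain ⟨k, hk⟩ := hfreq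
  have hkx : k ≠ x.1 := by
    rintro rfl
    exact hk (T.eventually_not_mem x hφ)
  have hlim : Tendsto (fun r => (T.frame x).point φ r) (𝓝[>] 0) (𝓝 (T.pt x)) := by
    have := (T.frame x).tendsto_point_radius φ 0 (Ioi 0)
    rwa [show (T.frame x).point φ 0 = T.pt x from Subtype.ext (IsFrame.point_zero _ _)] at this
  have hmem : T.pt x ∈ T.tileRegion k :=
    (isClosed_sphereMap_image _ T.tile.region_closed).mem_of_frequently_of_tendsto hk hlim
  obtain ⟨y, rfl, hy⟩ := T.exists_flag_of_pt_mem x hmem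
  refine ⟨y, hkx, hy, ?_⟩
  have hyF := T.frame y
  have h1 : IsFrame (T.pt y : E3) (T.dirv x) (T.nor x) := hy ▸ T.frame x
  obtain ⟨ψ, hψ, he⟩ := hyF.exists_turn (h1.norm_turn φ) (h1.inner_v_turn φ)
  refine ⟨ψ, ⟨hψ.1, ?_⟩, he⟩
  by_contra hcon
  push Not at hcon
  obtain ⟨r, hr, hr'⟩ := (hk.and_eventually (T.eventually_not_mem y ⟨hcon, hψ.2⟩)).exists
  refine hr' ?_
  have : (T.frame x).point φ r = (T.frame y).point ψ r := by
    apply Subtype.ext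
    rw [IsFrame.coe_point, IsFrame.coe_point, he, hy]
  rwa [← this]

/-- Across the edge of a flag, there is a flag of another tile. -/
lemma exists_across (x : TileFlag f) :
    ∃ y : TileFlag f, y.1 ≠ x.1 ∧ T.pt y = T.pt x ∧ T.dirv y = T.dirv x := by
  -- A flag whose closed sector contains directions arbitrarily close to the outer side of the edge.
  have hev : ∀ᶠ φ in 𝓝[<] (2 * π), ∃ y : TileFlag f, (y.1 ≠ x.1 ∧ T.pt y = T.pt x) ∧
      ∃ ψ ∈ Icc 0 (T.width y), turn (T.dirv y) (T.nor y) ψ = turn (T.dirv x) (T.nor x) φ := by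
    filter_upwards [Ioo_mem_nhdsLT (T.width_mem x).2] with φ hφ
    obtain ⟨y, h1, h2, ψ, hψ, he⟩ := T.exists_flag_of_direction x hφ
    exact ⟨y, ⟨h1, h2⟩, ψ, hψ, he.symm⟩
  have hfreq : ∃ y : TileFlag f, ∃ᶠ φ in 𝓝[<] (2 * π), (y.1 ≠ x.1 ∧ T.pt y = T.pt x) ∧
      ∃ ψ ∈ Icc 0 (T.width y), turn (T.dirv y) (T.nor y) ψ = turn (T.dirv x) (T.nor x) φ := by
    by_contra hcon
    push Not at hcon
    obtain ⟨φ, h1, y, h2, ψ, h3, h4⟩ := ((eventually_all.mpr hcon).and hev).exists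
    exact h1 y h2 ψ h3 h4
  obtain ⟨y, hy⟩ := hfreq
  obtain ⟨-, ⟨hne, hp⟩, -⟩ := hy.exists
  have hcl : IsClosed (turn (T.dirv y) (T.nor y) '' Icc 0 (T.width y)) :=
    (isCompact_Icc.image (continuous_geodesic _ _)).isClosed
  have hlim : Tendsto (turn (T.dirv x) (T.nor x)) (𝓝[<] (2 * π))
      (𝓝 (turn (T.dirv x) (T.nor x) (2 * π))) :=
    ((continuous_geodesic _ _).tendsto _).mono_left nhdsWithin_le_nhds
  obtain ⟨ψ, hψ, he⟩ := hcl.mem_of_frequently_of_tendsto (hy.mono fun φ h => h.2) hlim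
  rw [← zero_add (2 * π), turn_add_two_pi, turn_zero] at he
  rcases hψ.1.eq_or_lt with h0 | h0
  · exact ⟨y, hne, hp, by rw [← he, ← h0, turn_zero]⟩
  rcases hψ.2.eq_or_lt with h1 | h1
  · exact ⟨y.opp, by rwa [y.opp_fst], by rw [T.pt_opp, hp], by rw [T.dirv_opp, ← h1, he]⟩
  -- The edge cannot point into the open sector of `y`.
  exfalso
  have hxF : IsFrame (T.pt y : E3) (T.dirv x) (T.nor x) := hp ▸ T.frame x
  obtain ⟨θ, hθ, hux, e, he1, hrot⟩ := (T.frame y).exists_rotation hxF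
  have hθψ : θ = ψ := (T.frame y).turn_inj hθ ⟨h0.le, h1.trans (T.width_mem y).2⟩
    (by rw [← hux, he])
  subst hθψ
  have hm : 0 < min (T.width x) (min θ (T.width y - θ)) :=
    lt_min (T.width_mem x).1 (lt_min h0 (by linarith))
  have ha : min (T.width x) (min θ (T.width y - θ)) ≤ T.width x := min_le_left _ _
  have hb : min (T.width x) (min θ (T.width y - θ)) ≤ θ :=
    (min_le_right _ _).trans (min_le_left _ _)
  have hc : min (T.width x) (min θ (T.width y - θ)) ≤ T.width y - θ :=
    (min_le_right _ _).trans (min_le_right _ _)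
  refine T.turn_ne_turn hp.symm hne.symm (φ := min (T.width x) (min θ (T.width y - θ)) / 2)
    ⟨by linarith, by linarith⟩ ?_ (hrot _)
  rcases he1 with rfl | rfl
  · constructor <;> linarith
  · constructor <;> linarith

/-- The flag of the neighbouring tile across the edge of a flag, at the same end of this edge. -/
noncomputable def across (x : TileFlag f) : TileFlag f := (T.exists_across x).choose

lemma across_fst_ne (x : TileFlag f) : (T.across x).1 ≠ x.1 := (T.exists_across x).choose_spec.1

lemma pt_across (x : TileFlag f) : T.pt (T.across x) = T.pt x :=
  (T.exists_across x).choose_spec.2.1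

lemma dirv_across (x : TileFlag f) : T.dirv (T.across x) = T.dirv x :=
  (T.exists_across x).choose_spec.2.2

lemma nor_across (x : TileFlag f) : T.nor (T.across x) = -T.nor x :=
  T.nor_eq_neg (T.pt_across x).symm (T.dirv_across x).symm (T.across_fst_ne x).symm

lemma across_unique {x y : TileFlag f} (hp : T.pt y = T.pt x) (hd : T.dirv y = T.dirv x)
    (hne : y ≠ x) : T.across x = y := by
  have hn0 : T.nor x ≠ 0 := by
    intro h0
    have := (T.frame x).norm_n
    rw [h0, norm_zero] at this
    exact zero_ne_one this
  have hsame : ∀ {z w : TileFlag f}, T.pt w = T.pt z → T.dirv w = T.dirv z → z.1 = w.1 →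
      w = z := by
    intro z w hp hd ht
    rcases T.eq_or_eq_opp hp.symm ht with h | h
    · exact h
    exfalso
    rw [h, T.dirv_opp] at hd
    have hw := T.width_mem z
    have := (T.frame z).turn_inj ⟨hw.1.le, hw.2⟩ ⟨le_rfl, two_pi_pos⟩ (hd.trans (turn_zero _ _).symm)
    exact hw.1.ne' this
  have htx : x.1 ≠ y.1 := fun h => hne (hsame hp hd h)
  by_contra hcon
  have hty : y.1 ≠ (T.across x).1 := fun h =>
    hcon (hsame ((T.pt_across x).trans hp.symm) ((T.dirv_across x).trans hd.symm) h)
  have h1 := T.nor_eq_neg hp.symm hd.symm htx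
  have h2 := T.nor_eq_neg (hp.trans (T.pt_across x).symm) (hd.trans (T.dirv_across x).symm) hty
  rw [h1, T.nor_across, neg_neg] at h2
  have h3 : (2 : ℝ) • T.nor x = 0 := by
    rw [two_smul]
    nth_rw 1 [← h2]
    exact neg_add_cancel _
  exact hn0 ((smul_eq_zero.mp h3).resolve_left two_ne_zero)

lemma across_ne (x : TileFlag f) : T.across x ≠ x := fun h => T.across_fst_ne x (by rw [h])

lemma across_across (x : TileFlag f) : T.across (T.across x) = x :=
  T.across_unique (T.pt_across x).symm (T.dirv_across x).symm (T.across_ne x).symm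

lemma flagLen_across (x : TileFlag f) : T.flagLen (T.across x) = T.flagLen x := by
  have key : ∀ y z : TileFlag f, T.pt y = T.pt z → T.dirv y = T.dirv z →
      T.flagLen y ≤ T.flagLen z := by
    intro y z hp hd
    have hz := T.flagLen_pos z
    have hy := T.flagLen_pos y
    have heq : T.flagEdge y = T.flagEdge z := by
      have hm : 0 < min (T.flagLen y) (T.flagLen z) := lt_min hy hz
      set t := min (T.flagLen y) (T.flagLen z) / 2 with ht
      have ht1 : t < T.flagLen y := by
        linarith [min_le_left (T.flagLen y) (T.flagLen z)]
      have ht2 : t ≤ T.flagLen z := by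
        linarith [min_le_right (T.flagLen y) (T.flagLen z)]
      have ht0 : 0 < t := by linarith
      obtain ⟨p, hpt⟩ : ∃ p : S2, (p : E3) = geodesic (T.pt y) (T.dirv y) t :=
        ⟨⟨_, mem_sphere_zero_iff_norm.mpr ((T.frame y).norm_geodesic t)⟩, rfl⟩
      refine T.edge_to_edge y.1 y.2.1 z.1 z.2.1 ⟨p, ?_, ?_⟩
      · obtain ⟨q, hq, hqp⟩ := T.mem_flagEdge_iff.mpr ⟨t, ⟨ht0.le, ht1.le⟩, hpt⟩
        refine ⟨q, ?_, hqp⟩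
        have hne : ∀ s ∈ Icc 0 (T.flagLen y), s ≠ t →
            p ≠ (⟨_, mem_sphere_zero_iff_norm.mpr ((T.frame y).norm_geodesic s)⟩ : S2) := by
          rintro s hs hst rfl
          exact hst (geodesic_inj (T.frame y).norm_v (T.frame y).norm_u (T.frame y).vu
            ⟨hs.1, hs.2.trans_lt (T.flagLen_lt y)⟩ ⟨ht0.le, ht1.trans (T.flagLen_lt y)⟩ hpt)
        have hend : p ≠ T.pt y ∧ p ≠ T.pt y.flip := by
          constructor
          · intro e
            exact hne 0 ⟨le_rfl, hy.le⟩ ht0.ne (e.trans (Subtype.ext (geodesic_zero _ _).symm))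
          · intro e
            exact hne _ ⟨hy.le, le_rfl⟩ ht1.ne' (e.trans (Subtype.ext (T.coe_pt_flip y)))
        rcases T.tile.edge_cases hq with h | h | h
        · exact h
        · exfalso
          rw [h] at hqp
          rcases y with ⟨i, j, _ | _⟩
          · exact hend.1 hqp.symm
          · exact hend.2 hqp.symm
        · exfalso
          rw [h] at hqp
          rcases y with ⟨i, j, _ | _⟩
          · exact hend.2 hqp.symm
          · exact hend.1 hqp.symm
      · exact T.mem_flagEdge_iff.mpr ⟨t, ⟨ht0.le, ht2⟩, by rw [hpt, hp, hd]⟩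
    have hmem := T.pt_mem_flagEdge y.flip
    rw [T.flagEdge_flip, heq, T.mem_flagEdge_iff, T.coe_pt_flip, hp, hd] at hmem
    obtain ⟨t, ht, he⟩ := hmem
    have := geodesic_inj (T.frame z).norm_v (T.frame z).norm_u (T.frame z).vu
      ⟨hy.le, T.flagLen_lt y⟩ ⟨ht.1, ht.2.trans_lt (T.flagLen_lt z)⟩ he
    rw [this]; exact ht.2
  exact le_antisymm (key _ _ (T.pt_across x) (T.dirv_across x))
    (key _ _ (T.pt_across x).symm (T.dirv_across x).symm)

/-- Neighbouring tiles share both ends of their common edge. -/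
lemma across_flip (x : TileFlag f) : T.across x.flip = (T.across x).flip := by
  refine T.across_unique (Subtype.ext ?_) ?_ ?_
  · rw [T.coe_pt_flip, T.coe_pt_flip, T.pt_across, T.dirv_across, T.flagLen_across]
  · rw [T.dirv_flip, T.dirv_flip, T.pt_across, T.dirv_across, T.flagLen_across]
  · intro h
    exact T.across_fst_ne x (by rw [← TileFlag.flip_fst, h, TileFlag.flip_fst])

end SphericalTiling

/-! ### Angle sums -/

/-- The determinant of `a, b` in the coordinates `u, n`: the orientation of an orthonormal pair of
tangent vectors with respect to a reference frame. -/
noncomputable def orient (u n a b : E3) : ℝ := inner ℝ u a * inner ℝ n b - inner ℝ n a * inner ℝ u b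

lemma orient_neg (u n a b : E3) : orient u n a (-b) = -orient u n a b := by
  simp only [orient, inner_neg_right]; ring

lemma orient_turn (u n a b : E3) (w : ℝ) :
    orient u n (turn a b w) (sin w • a - cos w • b) = -orient u n a b := by
  simp only [orient, turn, inner_add_right, inner_sub_right, inner_smul_right]
  linear_combination (-(inner ℝ u a * inner ℝ n b) + inner ℝ n a * inner ℝ u b) *
    sin_sq_add_cos_sq w

lemma IsFrame.orient_self {v u n : E3} (h : IsFrame v u n) : orient u n u n = 1 := by
  simp [orient, h.norm_u, h.norm_n, h.un]

/-- A positively oriented frame is a rotation of the reference frame. -/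
lemma IsFrame.exists_angle_of_orient {v u n a b : E3} (h : IsFrame v u n) (h' : IsFrame v a b) :
    (orient u n a b = 1 ∨ orient u n a b = -1) ∧ ∃ θ ∈ Ico 0 (2 * π), a = turn u n θ ∧
      (orient u n a b = 1 → ∀ φ, turn a b φ = turn u n (θ + φ)) := by
  obtain ⟨θ, hθ, ha, e, he, hrot⟩ := h.exists_rotation h'
  have hb : b = turn u n (θ + e * (π / 2)) := by
    rw [← hrot, turn, cos_pi_div_two, sin_pi_div_two, zero_smul, one_smul, zero_add]
  have ho : orient u n a b = e := by
    rw [orient, ha, hb, h.inner_u_turn, h.inner_n_turn, h.inner_u_turn, h.inner_n_turn,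
      mul_comm (sin θ), mul_comm (cos θ), ← sin_sub]
    rcases he with rfl | rfl <;> simp
  rw [ho]
  refine ⟨he, θ, hθ, ha, fun h1 φ => ?_⟩
  rw [hrot, h1, one_mul]

namespace SphericalTiling

variable {f : ℕ} (T : SphericalTiling f)

lemma orient_opp (u n : E3) (x : TileFlag f) :
    orient u n (T.dirv x.opp) (T.nor x.opp) = -orient u n (T.dirv x) (T.nor x) := by
  rw [T.dirv_opp, T.nor_opp, orient_turn]

lemma orient_across (u n : E3) (x : TileFlag f) :
    orient u n (T.dirv (T.across x)) (T.nor (T.across x)) = -orient u n (T.dirv x) (T.nor x) := by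
  rw [T.dirv_across, T.nor_across, orient_neg]

/-- Those flags of `K` that have the same orientation as the reference flag. -/
noncomputable def positive (x₀ : TileFlag f) (K : Finset (TileFlag f)) : Finset (TileFlag f) :=
  open Classical in
  K.filter fun x => orient (T.dirv x₀) (T.nor x₀) (T.dirv x) (T.nor x) = 1

lemma mem_positive {x₀ x : TileFlag f} {K : Finset (TileFlag f)} : x ∈ T.positive x₀ K ↔
    x ∈ K ∧ orient (T.dirv x₀) (T.nor x₀) (T.dirv x) (T.nor x) = 1 := by
  classical
  rw [positive, Finset.mem_filter]

lemma orient_eq {x₀ x : TileFlag f} (hp : T.pt x = T.pt x₀) :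
    orient (T.dirv x₀) (T.nor x₀) (T.dirv x) (T.nor x) = 1 ∨
      orient (T.dirv x₀) (T.nor x₀) (T.dirv x) (T.nor x) = -1 := by
  have h := T.frame x
  rw [hp] at h
  exact ((T.frame x₀).exists_angle_of_orient h).1

/-- Going around a vertex from corner to corner, the angles add up to a multiple of a full turn. -/
lemma sum_width_eq_zero (x₀ : TileFlag f) (K : Finset (TileFlag f))
    (hp : ∀ x ∈ K, T.pt x = T.pt x₀) (hopp : ∀ x ∈ K, x.opp ∈ K)
    (hacr : ∀ x ∈ K, T.across x ∈ K) :
    ((∑ x ∈ T.positive x₀ K, T.width x : ℝ) : Real.Angle) = 0 := by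
  set u := T.dirv x₀
  set n := T.nor x₀
  have hF : IsFrame (T.pt x₀ : E3) u n := T.frame x₀
  have hth : ∀ x : TileFlag f, ∃ θ : ℝ, x ∈ K → T.dirv x = turn u n θ ∧
      (orient u n (T.dirv x) (T.nor x) = 1 →
        ∀ φ, turn (T.dirv x) (T.nor x) φ = turn u n (θ + φ)) := by
    intro x
    by_cases hx : x ∈ K
    · have h := T.frame x
      rw [hp x hx] at h
      obtain ⟨-, θ, -, h1, h2⟩ := hF.exists_angle_of_orient h
      exact ⟨θ, fun _ => ⟨h1, h2⟩⟩
    · exact ⟨0, fun h => absurd h hx⟩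
  choose θ hθ using hth
  have hturn : ∀ a b : ℝ, turn u n a = turn u n b → (a : Real.Angle) = b := by
    intro a b hab
    have hc : cos a = cos b := by rw [← hF.inner_u_turn, hab, hF.inner_u_turn]
    have hs : sin a = sin b := by rw [← hF.inner_n_turn, hab, hF.inner_n_turn]
    exact Real.Angle.cos_sin_inj hc hs
  have hnext : ∀ x ∈ T.positive x₀ K, T.across x.opp ∈ T.positive x₀ K := by
    intro x hx
    rw [mem_positive] at hx ⊢
    exact ⟨hacr _ (hopp _ hx.1), by rw [T.orient_across, T.orient_opp, neg_neg, hx.2]⟩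
  have hprev : ∀ x ∈ T.positive x₀ K, (T.across x).opp ∈ T.positive x₀ K := by
    intro x hx
    rw [mem_positive] at hx ⊢
    exact ⟨hopp _ (hacr _ hx.1), by rw [T.orient_opp, T.orient_across, neg_neg, hx.2]⟩
  have hstep : ∀ x ∈ T.positive x₀ K,
      ((θ (T.across x.opp) : ℝ) : Real.Angle) = (θ x : Real.Angle) + (T.width x : Real.Angle) := by
    intro x hx
    have hx' := T.mem_positive.mp hx
    rw [← Real.Angle.coe_add]
    apply hturn
    rw [← (hθ x hx'.1).2 hx'.2, ← T.dirv_opp, ← T.dirv_across,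
      ← (hθ _ (hacr _ (hopp _ hx'.1))).1]
  have hsum : ∑ x ∈ T.positive x₀ K, ((θ (T.across x.opp) : ℝ) : Real.Angle) =
      ∑ x ∈ T.positive x₀ K, (θ x : Real.Angle) :=
    Finset.sum_nbij' (fun x => T.across x.opp) (fun x => (T.across x).opp) hnext hprev
      (fun x _ => by rw [T.across_across, x.opp_opp])
      (fun x _ => by rw [TileFlag.opp_opp, T.across_across]) (fun _ _ => rfl)
  rw [Finset.sum_congr rfl hstep, Finset.sum_add_distrib, add_eq_left] at hsum
  rw [← hsum]
  exact map_sum Real.Angle.coeHom _ _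

lemma two_pi_le_sum_width (x₀ : TileFlag f) (K : Finset (TileFlag f))
    (hp : ∀ x ∈ K, T.pt x = T.pt x₀) (hopp : ∀ x ∈ K, x.opp ∈ K)
    (hacr : ∀ x ∈ K, T.across x ∈ K) (hne : K.Nonempty) :
    2 * π ≤ ∑ x ∈ T.positive x₀ K, T.width x := by
  obtain ⟨k, hk⟩ := Real.Angle.coe_eq_zero_iff.mp (T.sum_width_eq_zero x₀ K hp hopp hacr)
  have hpos : 0 < ∑ x ∈ T.positive x₀ K, T.width x := by
    apply Finset.sum_pos fun x _ => (T.width_mem x).1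
    obtain ⟨x, hx⟩ := hne
    rcases T.orient_eq (hp x hx) with h | h
    · exact ⟨x, T.mem_positive.mpr ⟨hx, h⟩⟩
    · exact ⟨x.opp, T.mem_positive.mpr ⟨hopp x hx, by rw [T.orient_opp, h, neg_neg]⟩⟩
  rw [← hk] at hpos ⊢
  rw [zsmul_eq_mul] at hpos ⊢
  have h2 := two_pi_pos
  have h3 : (0 : ℝ) < k := by
    by_contra hcon
    push Not at hcon
    nlinarith
  have h4 : (1 : ℝ) ≤ k := by
    have : 0 < k := by exact_mod_cast h3
    exact_mod_cast this
  nlinarith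

/-- The sectors at a vertex are disjoint, so that their angles add up to at most a full turn. -/
lemma sum_width_le (x₀ : TileFlag f) (K : Finset (TileFlag f)) (hp : ∀ x ∈ K, T.pt x = T.pt x₀) :
    ∑ x ∈ T.positive x₀ K, T.width x ≤ 2 * π := by
  set u := T.dirv x₀
  set n := T.nor x₀
  have hF : IsFrame (T.pt x₀ : E3) u n := T.frame x₀
  have hth : ∀ x : TileFlag f, ∃ θ : ℝ, x ∈ T.positive x₀ K → θ ∈ Ico 0 (2 * π) ∧
      T.dirv x = turn u n θ ∧ ∀ φ, turn (T.dirv x) (T.nor x) φ = turn u n (θ + φ) := by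
    intro x
    by_cases hx : x ∈ T.positive x₀ K
    · have hx' := T.mem_positive.mp hx
      have h := T.frame x
      rw [hp x hx'.1] at h
      obtain ⟨-, θ, h0, h1, h2⟩ := hF.exists_angle_of_orient h
      exact ⟨θ, fun _ => ⟨h0, h1, h2 hx'.2⟩⟩
    · exact ⟨0, fun h => absurd h hx⟩
  choose θ hθ using hth
  have htile : ∀ x y : TileFlag f, T.pt x = T.pt y →
      orient u n (T.dirv x) (T.nor x) = 1 → orient u n (T.dirv y) (T.nor y) = 1 →
      x ≠ y → x.1 ≠ y.1 := by
    intro x y hxy hx hy hne ht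
    rcases T.eq_or_eq_opp hxy ht with h | h
    · exact hne h.symm
    · rw [h, T.orient_opp, hx] at hy; norm_num at hy
  have hsub : ∀ x ∈ T.positive x₀ K, Ioo (θ x) (θ x + T.width x) ⊆ Icc 0 (2 * π) := by
    intro x hx
    have hx' := T.mem_positive.mp hx
    obtain ⟨h0, h1, h2⟩ := hθ x hx
    have hw := T.width_mem x
    suffices h : θ x + T.width x ≤ 2 * π from
      fun z hz => ⟨by linarith [hz.1, h0.1], by linarith [hz.2]⟩
    by_cases hxx : x = x₀
    · have : θ x = 0 := by
        refine hF.turn_inj h0 ⟨le_rfl, two_pi_pos⟩ ?_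
        rw [← h1, turn_zero, hxx]
      rw [this, zero_add]
      exact hw.2.le
    -- Otherwise the sector overlaps the one of the reference flag, which begins at the angle zero.
    by_contra hcon
    push Not at hcon
    have hpx := hp x hx'.1
    have hw₀ := T.width_mem x₀
    have ht := htile x x₀ hpx hx'.2 hF.orient_self hxx
    obtain ⟨s, hs0, hs1⟩ : ∃ s, 0 < s ∧ s < min (T.width x₀) (θ x + T.width x - 2 * π) :=
      exists_between (lt_min hw₀.1 (by linarith))
    have ha := hs1.trans_le (min_le_left _ _)
    have hb := hs1.trans_le (min_le_right _ _)
    refine T.turn_ne_turn hpx ht (φ := 2 * π - θ x + s) (ψ := s)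
      ⟨by linarith [h0.2], by linarith⟩ ⟨hs0, ha⟩ ?_
    rw [h2, show θ x + (2 * π - θ x + s) = s + 2 * π by ring, turn_add_two_pi]
  have hdisj : (T.positive x₀ K : Set (TileFlag f)).PairwiseDisjoint
      fun x => Ioo (θ x) (θ x + T.width x) := by
    intro x hx y hy hne
    rw [Finset.mem_coe] at hx hy
    have hx' := T.mem_positive.mp hx
    have hy' := T.mem_positive.mp hy
    rw [Function.onFun, Set.disjoint_left]
    intro z hzx hzy
    have hxy : T.pt x = T.pt y := (hp x hx'.1).trans (hp y hy'.1).symm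
    refine T.turn_ne_turn hxy (htile x y hxy hx'.2 hy'.2 hne) (φ := z - θ x) (ψ := z - θ y)
      ⟨by linarith [hzx.1], by linarith [hzx.2]⟩ ⟨by linarith [hzy.1], by linarith [hzy.2]⟩ ?_
    rw [(hθ x hx).2.2, (hθ y hy).2.2]
    congr 1; ring
  have hvol := MeasureTheory.measure_mono (μ := MeasureTheory.volume) (iUnion₂_subset hsub)
  rw [MeasureTheory.measure_biUnion_finset hdisj fun _ _ => measurableSet_Ioo] at hvol
  simp only [Real.volume_Ioo, Real.volume_Icc, add_sub_cancel_left, sub_zero] at hvol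
  rw [← ENNReal.ofReal_sum_of_nonneg fun x _ => (T.width_mem x).1.le] at hvol
  exact (ENNReal.ofReal_le_ofReal_iff two_pi_pos.le).mp hvol

/-- The flags at a vertex form a single cycle under the passages to the other side of the corner
and to the neighbouring tile. -/
lemma mem_of_closed {K : Set (TileFlag f)} {x : TileFlag f} (hx : x ∈ K)
    (hp : ∀ y ∈ K, T.pt y = T.pt x) (hopp : ∀ y ∈ K, y.opp ∈ K)
    (hacr : ∀ y ∈ K, T.across y ∈ K) {z : TileFlag f} (hz : T.pt z = T.pt x) : z ∈ K := by
  classical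
  by_contra hcon
  set A := K.toFinset with hA
  set B : Finset (TileFlag f) := Finset.univ.filter fun y => T.pt y = T.pt x with hB
  have hmA : ∀ y, y ∈ A ↔ y ∈ K := fun y => by rw [hA, Set.mem_toFinset]
  have h1 := T.two_pi_le_sum_width x A (fun y hy => hp y ((hmA y).mp hy))
    (fun y hy => (hmA _).mpr (hopp y ((hmA y).mp hy)))
    (fun y hy => (hmA _).mpr (hacr y ((hmA y).mp hy))) ⟨x, (hmA x).mpr hx⟩
  have h2 := T.sum_width_le x B fun y hy => (Finset.mem_filter.mp hy).2
  obtain ⟨w, hwB, hwA⟩ : ∃ w, w ∈ T.positive x B ∧ w ∉ A := by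
    rcases T.orient_eq hz with h | h
    · exact ⟨z, T.mem_positive.mpr ⟨by simp [hB, hz], h⟩, by rwa [hmA]⟩
    · refine ⟨z.opp, T.mem_positive.mpr
        ⟨by simp [hB, hz, T.pt_opp], by rw [T.orient_opp, h, neg_neg]⟩, ?_⟩
      rw [hmA]
      intro h'
      exact hcon (z.opp_opp ▸ hopp _ h')
  have h3 : ∑ y ∈ T.positive x A, T.width y < ∑ y ∈ T.positive x B, T.width y := by
    refine Finset.sum_lt_sum_of_subset (i := w) ?_ hwB (fun h => hwA (T.mem_positive.mp h).1)
      (T.width_mem w).1 fun y _ _ => (T.width_mem y).1.le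
    intro y hy
    rw [mem_positive] at hy ⊢
    exact ⟨by simp [hB, hp y ((hmA y).mp hy.1)], hy.2⟩
  linarith

/-- The angles of the corners at a vertex add up to a full turn. -/
lemma angle_sum (x : TileFlag f) :
    ∑ l, (T.vertexType (T.pt x) l : ℝ) * T.tile.angle l = 2 * π := by
  classical
  set B : Finset (TileFlag f) := Finset.univ.filter fun y => T.pt y = T.pt x with hB
  have hmB : ∀ y, y ∈ B ↔ T.pt y = T.pt x := fun y => by simp [hB]
  have hsum : ∑ y ∈ T.positive x B, T.width y = 2 * π := by
    refine le_antisymm (T.sum_width_le x B fun y hy => (hmB y).mp hy) ?_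
    refine T.two_pi_le_sum_width x B (fun y hy => (hmB y).mp hy) (fun y hy => ?_) (fun y hy => ?_)
      ⟨x, by rw [hmB]⟩
    · rw [hmB, T.pt_opp]; exact (hmB y).mp hy
    · rw [hmB, T.pt_across]; exact (hmB y).mp hy
  rw [← hsum]
  -- Each corner at the vertex has exactly one positive flag.
  have hcor : ∑ y ∈ T.positive x B, T.width y =
      ∑ c ∈ Finset.univ.filter (fun c : Fin f × Fin 4 => T.corner c.1 c.2 = T.pt x),
        T.tile.angle c.2 := by
    refine Finset.sum_bij (fun y _ => (y.1, y.idx)) ?_ ?_ ?_ (fun _ _ => rfl)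
    · intro y hy
      exact Finset.mem_filter.mpr ⟨Finset.mem_univ _, (hmB y).mp (T.mem_positive.mp hy).1⟩
    · intro y hy z hz he
      obtain ⟨h1, h2⟩ := Prod.mk.inj he
      rcases TileFlag.eq_or_eq_opp h1 h2 with h | h
      · exact h.symm
      · exfalso
        have hy' := (T.mem_positive.mp hy).2
        have hz' := (T.mem_positive.mp hz).2
        rw [h, T.orient_opp, hy'] at hz'
        norm_num at hz'
    · rintro ⟨i, j⟩ hc
      have hc' : T.pt (i, j, false) = T.pt x := (Finset.mem_filter.mp hc).2
      rcases T.orient_eq hc' with h | h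
      · exact ⟨(i, j, false), T.mem_positive.mpr ⟨(hmB _).mpr hc', h⟩, rfl⟩
      · refine ⟨TileFlag.opp (i, j, false), T.mem_positive.mpr
          ⟨(hmB _).mpr (by rw [T.pt_opp, hc']), by rw [T.orient_opp, h, neg_neg]⟩, ?_⟩
        rw [TileFlag.opp_fst, TileFlag.idx_opp]; rfl
  rw [hcor, Finset.sum_filter, Fintype.sum_prod_type_right]
  refine Finset.sum_congr rfl fun l _ => ?_
  dsimp only
  rw [← Finset.sum_filter, Finset.sum_const, nsmul_eq_mul]
  congr 2
  rw [vertexType, Set.ncard_eq_toFinset_card']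
  congr 1
  ext i; simp

end SphericalTiling

/-! ### Combinatorics of the vertices -/

namespace SphericalTiling

variable {f : ℕ} (T : SphericalTiling f)

lemma across_eq_comm {x y : TileFlag f} (h : T.across x = y) : T.across y = x := by
  rw [← h, T.across_across]

lemma pt_eq_of_across {x y : TileFlag f} (h : T.across x = y) : T.pt y = T.pt x := by
  rw [← h, T.pt_across]

lemma across_flip_eq {x y : TileFlag f} (h : T.across x = y) : T.across x.flip = y.flip := by
  rw [← h, T.across_flip]

lemma fst_ne_of_across {x y : TileFlag f} (h : T.across x = y) : y.1 ≠ x.1 := by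
  rw [← h]; exact T.across_fst_ne x

/-- If two corners are adjacent on both sides, then there are no other corners at the vertex. -/
lemma idx_of_two_cycle {x y z : TileFlag f} (h1 : T.across x = y) (h2 : T.across x.opp = y.opp)
    (hz : T.pt z = T.pt x) : z.idx = x.idx ∨ z.idx = y.idx := by
  have hy := T.pt_eq_of_across h1
  have hmem : z ∈ ({x, x.opp, y, y.opp} : Set (TileFlag f)) := by
    refine T.mem_of_closed (x := x) (by simp) ?_ ?_ ?_ hz
    · rintro w (rfl | rfl | rfl | rfl)
      · rfl
      · rw [T.pt_opp]
      · exact hy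
      · rw [T.pt_opp, hy]
    · rintro w (rfl | rfl | rfl | rfl) <;> simp [TileFlag.opp_opp]
    · rintro w (rfl | rfl | rfl | rfl)
      · simp [h1]
      · simp [h2]
      · simp [T.across_eq_comm h1]
      · simp [T.across_eq_comm h2]
  rcases hmem with rfl | rfl | rfl | rfl
  · exact Or.inl rfl
  · exact Or.inl (TileFlag.idx_opp _)
  · exact Or.inr rfl
  · exact Or.inr (TileFlag.idx_opp _)

lemma exists_corner_of_ne_zero {p : S2} {j : Fin 4} (h : T.vertexType p j ≠ 0) :
    ∃ i, T.corner i j = p := by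
  by_contra hcon
  push Not at hcon
  refine h ?_
  rw [vertexType, Set.ncard_eq_zero]
  ext i; simp [hcon i]

lemma vertexType_ne_zero (i : Fin f) (j : Fin 4) : T.vertexType (T.corner i j) j ≠ 0 := by
  intro h
  rw [vertexType, Set.ncard_eq_zero] at h
  have : i ∈ ({i' | T.corner i' j = T.corner i j} : Set (Fin f)) := rfl
  rw [h] at this
  exact this

lemma corner_eq_of_one {p : S2} {j : Fin 4} (h : T.vertexType p j = 1) {i k : Fin f}
    (hi : T.corner i j = p) (hk : T.corner k j = p) : i = k := by
  obtain ⟨a, ha⟩ := Set.ncard_eq_one.mp h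
  have h1 : i ∈ ({i | T.corner i j = p} : Set (Fin f)) := hi
  have h2 : k ∈ ({i | T.corner i j = p} : Set (Fin f)) := hk
  rw [ha] at h1 h2
  rw [h1, h2]

lemma corner_eq_of_two {p : S2} {j : Fin 4} (h : T.vertexType p j = 2) {i k l : Fin f}
    (hi : T.corner i j = p) (hk : T.corner k j = p) (hl : T.corner l j = p) (hki : k ≠ i)
    (hli : l ≠ i) : l = k := by
  obtain ⟨a, b, -, hab⟩ := Set.ncard_eq_two.mp h
  have h1 : i ∈ ({i | T.corner i j = p} : Set (Fin f)) := hi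
  have h2 : k ∈ ({i | T.corner i j = p} : Set (Fin f)) := hk
  have h3 : l ∈ ({i | T.corner i j = p} : Set (Fin f)) := hl
  rw [hab] at h1 h2 h3
  rcases h1 with rfl | rfl <;> rcases h2 with rfl | rfl <;> rcases h3 with rfl | rfl <;>
    first | rfl | exact absurd rfl hki | exact absurd rfl hli

section edges

variable (h : T.tile.IsA2BC)
include h

lemma across_b (i : Fin f) (s : Bool) : ∃ k s', k ≠ i ∧ T.across (i, 1, s) = (k, 1, s') := by
  have hl := T.flagLen_across (i, 1, s)
  have hne := T.across_fst_ne (i, 1, s)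
  obtain ⟨h3, h1, h2, h12⟩ := h
  rcases hx : T.across (i, 1, s) with ⟨k, e, s'⟩
  rw [hx] at hl hne
  refine ⟨k, s', hne, ?_⟩
  simp only [flagLen] at hl
  fin_cases e <;> simp_all [eq_comm]

lemma across_c (i : Fin f) (s : Bool) : ∃ k s', k ≠ i ∧ T.across (i, 2, s) = (k, 2, s') := by
  have hl := T.flagLen_across (i, 2, s)
  have hne := T.across_fst_ne (i, 2, s)
  obtain ⟨h3, h1, h2, h12⟩ := h
  rcases hx : T.across (i, 2, s) with ⟨k, e, s'⟩
  rw [hx] at hl hne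
  refine ⟨k, s', hne, ?_⟩
  simp only [flagLen] at hl
  fin_cases e <;> simp_all [eq_comm]

lemma across_a (i : Fin f) {e : Fin 4} (he : e = 0 ∨ e = 3) (s : Bool) :
    ∃ k e' s', k ≠ i ∧ (e' = 0 ∨ e' = 3) ∧ T.across (i, e, s) = (k, e', s') := by
  have hl := T.flagLen_across (i, e, s)
  have hne := T.across_fst_ne (i, e, s)
  obtain ⟨h3, h1, h2, h12⟩ := h
  rcases hx : T.across (i, e, s) with ⟨k, e', s'⟩
  rw [hx] at hl hne
  refine ⟨k, e', s', hne, ?_, rfl⟩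
  simp only [flagLen] at hl
  rcases he with rfl | rfl <;> fin_cases e' <;> simp_all

/-- At a vertex without `B`, the neighbour of a corner `C` across the edge of length `b` is a
corner `C`. -/
lemma across_C_b {i : Fin f} (hB : ∀ k, T.corner k 1 ≠ T.corner i 2) :
    ∃ k, k ≠ i ∧ T.across (i, 1, true) = (k, 1, true) := by
  obtain ⟨k, s, hk, he⟩ := T.across_b h i true
  cases s
  · exact absurd (T.pt_eq_of_across he) (hB k)
  · exact ⟨k, hk, he⟩

lemma across_B_b {i : Fin f} (hC : ∀ k, T.corner k 2 ≠ T.corner i 1) :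
    ∃ k, k ≠ i ∧ T.across (i, 1, false) = (k, 1, false) := by
  obtain ⟨k, s, hk, he⟩ := T.across_b h i false
  cases s
  · exact ⟨k, hk, he⟩
  · exact absurd (T.pt_eq_of_across he) (hC k)

lemma across_C_c {i : Fin f} (hD : ∀ k, T.corner k 3 ≠ T.corner i 2) :
    ∃ k, k ≠ i ∧ T.across (i, 2, false) = (k, 2, false) := by
  obtain ⟨k, s, hk, he⟩ := T.across_c h i false
  cases s
  · exact ⟨k, hk, he⟩
  · exact absurd (T.pt_eq_of_across he) (hD k)

lemma across_D_c {i : Fin f} (hC : ∀ k, T.corner k 2 ≠ T.corner i 3) :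
    ∃ k, k ≠ i ∧ T.across (i, 2, true) = (k, 2, true) := by
  obtain ⟨k, s, hk, he⟩ := T.across_c h i true
  cases s
  · exact absurd (T.pt_eq_of_across he) (hC k)
  · exact ⟨k, hk, he⟩

/-- The four possible neighbours across an edge of length `a`. -/
lemma across_a_cases (i : Fin f) {e : Fin 4} (he : e = 0 ∨ e = 3) (s : Bool) : ∃ k, k ≠ i ∧
    (T.across (i, e, s) = (k, 0, false) ∨ T.across (i, e, s) = (k, 3, true) ∨
      T.across (i, e, s) = (k, 0, true) ∨ T.across (i, e, s) = (k, 3, false)) := by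
  obtain ⟨k, e', s', hk, he', ha⟩ := T.across_a h i he s
  refine ⟨k, hk, ?_⟩
  rcases he' with rfl | rfl <;> cases s' <;> simp [ha]

lemma across_D_a {i : Fin f} (hA : ∀ k, T.corner k 0 ≠ T.corner i 3)
    (hB : ∀ k, T.corner k 1 ≠ T.corner i 3) :
    ∃ k, k ≠ i ∧ T.across (i, 3, false) = (k, 3, false) := by
  obtain ⟨k, hk, he | he | he | he⟩ := T.across_a_cases h i (Or.inr rfl) false
  · exact absurd (T.pt_eq_of_across he) (hA k)
  · exact absurd (T.pt_eq_of_across he) (hA k)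
  · exact absurd (T.pt_eq_of_across he) (hB k)
  · exact ⟨k, hk, he⟩

/-- A vertex with a corner `A` but without `B` and `D` has only corners `A`. -/
lemma idx_eq_zero {i : Fin f} (hB : ∀ k, T.corner k 1 ≠ T.corner i 0)
    (hD : ∀ k, T.corner k 3 ≠ T.corner i 0) {k : Fin f} {j : Fin 4}
    (hk : T.corner k j = T.corner i 0) : j = 0 := by
  have hmem : ((k, j, false) : TileFlag f) ∈
      {x : TileFlag f | T.pt x = T.corner i 0 ∧ x.idx = 0} := by
    refine T.mem_of_closed (K := {x : TileFlag f | T.pt x = T.corner i 0 ∧ x.idx = 0})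
      (x := (i, 0, false)) ⟨rfl, rfl⟩ (fun y hy => hy.1) ?_ ?_ hk
    · exact fun y hy => ⟨by rw [T.pt_opp, hy.1], by rw [TileFlag.idx_opp, hy.2]⟩
    · rintro ⟨l, e, s⟩ ⟨hp, he⟩
      have hea : e = 0 ∨ e = 3 := by
        cases s <;> fin_cases e <;> simp [TileFlag.idx] at he ⊢
      refine ⟨by rw [T.pt_across, hp], ?_⟩
      obtain ⟨m, -, hm | hm | hm | hm⟩ := T.across_a_cases h l hea s
      · rw [hm]; rfl
      · rw [hm]; rfl
      · exact absurd ((T.pt_eq_of_across hm).trans hp) (hB m)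
      · exact absurd ((T.pt_eq_of_across hm).trans hp) (hD m)
  exact hmem.2

/-- At a vertex `γ²δ²` no two corners `D` are adjacent across the edge of length `c`. -/
lemma across_D_ne_D {i k : Fin f} (hv : T.vertexType (T.corner i 3) = ![0, 0, 2, 2]) :
    T.across (i, 2, true) ≠ (k, 2, true) := by
  intro hk
  have hnot : ∀ j : Fin 4, T.vertexType (T.corner i 3) j = 0 → ∀ l, T.corner l j ≠ T.corner i 3 :=
    fun j hj l hl => T.vertexType_ne_zero l j (by rw [hl]; exact hj)
  obtain ⟨l, hl, hla⟩ := T.across_D_a h (hnot 0 (by rw [hv]; rfl)) (hnot 1 (by rw [hv]; rfl))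
  have hlk : l = k := T.corner_eq_of_two (p := T.corner i 3) (j := 3) (by rw [hv]; rfl) rfl
    (T.pt_eq_of_across hk) (T.pt_eq_of_across hla) (T.fst_ne_of_across hk) hl
  subst hlk
  obtain ⟨m, hm⟩ := T.exists_corner_of_ne_zero (p := T.corner i 3) (j := 2) (by rw [hv]; decide)
  have := T.idx_of_two_cycle (z := (m, 2, false)) hk hla hm
  revert this
  simp [TileFlag.idx]

/-- At a vertex `γ²δ²` no two corners `C` are adjacent across the edge of length `c`. -/
lemma across_C_ne_C {i k : Fin f} (hv : T.vertexType (T.corner i 2) = ![0, 0, 2, 2]) :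
    T.across (i, 2, false) ≠ (k, 2, false) := by
  intro hk
  have hnot : ∀ j : Fin 4, T.vertexType (T.corner i 2) j = 0 → ∀ l, T.corner l j ≠ T.corner i 2 :=
    fun j hj l hl => T.vertexType_ne_zero l j (by rw [hl]; exact hj)
  obtain ⟨l, hl, hla⟩ := T.across_C_b h (hnot 1 (by rw [hv]; rfl))
  have hlk : l = k := T.corner_eq_of_two (p := T.corner i 2) (j := 2) (by rw [hv]; rfl) rfl
    (T.pt_eq_of_across hk) (T.pt_eq_of_across hla) (T.fst_ne_of_across hk) hl
  subst hlk
  obtain ⟨m, hm⟩ := T.exists_corner_of_ne_zero (p := T.corner i 2) (j := 3) (by rw [hv]; decide)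
  have := T.idx_of_two_cycle (z := (m, 3, false)) hk hla hm
  revert this
  simp [TileFlag.idx]

/-- At a vertex `αβ²` no two corners `B` are adjacent across an edge of length `a`. -/
lemma across_B_ne_B {i k : Fin f} (hv : T.vertexType (T.corner i 1) = ![1, 2, 0, 0]) :
    T.across (i, 0, true) ≠ (k, 0, true) := by
  intro hk
  have hnot : ∀ j : Fin 4, T.vertexType (T.corner i 1) j = 0 → ∀ l, T.corner l j ≠ T.corner i 1 :=
    fun j hj l hl => T.vertexType_ne_zero l j (by rw [hl]; exact hj)
  obtain ⟨l, hl, hla⟩ := T.across_B_b h (hnot 2 (by rw [hv]; rfl))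
  have hlk : l = k := T.corner_eq_of_two (p := T.corner i 1) (j := 1) (by rw [hv]; rfl) rfl
    (T.pt_eq_of_across hk) (T.pt_eq_of_across hla) (T.fst_ne_of_across hk) hl
  subst hlk
  obtain ⟨m, hm⟩ := T.exists_corner_of_ne_zero (p := T.corner i 1) (j := 0) (by rw [hv]; decide)
  have := T.idx_of_two_cycle (z := (m, 0, false)) hk hla hm
  revert this
  simp [TileFlag.idx]

/-- If `B` occurs only at vertices `αβ²` and `C` only at vertices `γ²δ²` and `γ^m`, then there is no
vertex `γ²δ²`. -/
lemma no_vertex_CCDD (hB : ∀ i, T.vertexType (T.corner i 1) = ![1, 2, 0, 0])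
    (hC : ∀ i, T.vertexType (T.corner i 2) = ![0, 0, 2, 2] ∨ (T.vertexType (T.corner i 2) 0 = 0 ∧
      T.vertexType (T.corner i 2) 1 = 0 ∧ T.vertexType (T.corner i 2) 3 = 0)) (i₁ : Fin f) :
    T.vertexType (T.corner i₁ 3) ≠ ![0, 0, 2, 2] := by
  intro hq
  have hnot : ∀ {p : S2} {j : Fin 4}, T.vertexType p j = 0 → ∀ l, T.corner l j ≠ p :=
    fun hj l hl => T.vertexType_ne_zero l _ (by rw [hl]; exact hj)
  have hBD : ∀ i k, T.corner k 3 ≠ T.corner i 1 := fun i => hnot (by rw [hB]; rfl)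
  have hBC : ∀ i k, T.corner k 2 ≠ T.corner i 1 := fun i => hnot (by rw [hB]; rfl)
  have hCA : ∀ i k, T.corner k 0 ≠ T.corner i 2 := by
    intro i
    rcases hC i with hv | hv
    · exact hnot (by rw [hv]; rfl)
    · exact hnot hv.1
  -- Across `AB`, a corner `A` cannot be adjacent to another corner `A`.
  have hAB : ∀ i, ∃ k, T.across (i, 0, false) = (k, 0, true) ∨
      T.across (i, 0, false) = (k, 3, false) := by
    intro i
    obtain ⟨k, -, he | he | he | he⟩ := T.across_a_cases h i (Or.inl rfl) false
    · exact absurd (T.across_flip_eq he) (T.across_B_ne_B h (hB i))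
    · exact absurd (T.pt_eq_of_across (T.across_flip_eq he)) (hBD i k)
    · exact ⟨k, Or.inl he⟩
    · exact ⟨k, Or.inr he⟩
  -- The two corners `D` at the vertex `γ²δ²` share an edge `DA`.
  obtain ⟨i₂, hi₂, h12⟩ := T.across_D_a h (i := i₁) (hnot (by rw [hq]; rfl)) (hnot (by rw [hq]; rfl))
  have h12' : T.across (i₁, 3, true) = (i₂, 3, true) := T.across_flip_eq h12
  have hA12 : T.corner i₂ 0 = T.corner i₁ 0 := T.pt_eq_of_across h12'
  -- Hence the corner `A` at the other end is adjacent to a corner `D` across `AB`.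
  obtain ⟨i₅, h15⟩ : ∃ k, T.across (i₁, 0, false) = (k, 3, false) := by
    obtain ⟨k, hk | hk⟩ := hAB i₁
    · exfalso
      have hp : T.corner k 1 = T.corner i₁ 0 := T.pt_eq_of_across hk
      exact hi₂ (T.corner_eq_of_one (p := T.corner k 1) (j := 0) (by rw [hB]; rfl)
        (hA12.trans hp.symm) hp.symm)
    · exact ⟨k, hk⟩
  have hU : T.corner i₅ 3 = T.corner i₁ 0 := T.pt_eq_of_across h15
  have h15' : T.across (i₁, 0, true) = (i₅, 3, true) := T.across_flip_eq h15
  have hW : T.corner i₅ 0 = T.corner i₁ 1 := T.pt_eq_of_across h15'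
  -- The tile `i₅` has its corner `C` at a vertex `γ^m`.
  obtain ⟨k, -, hDD⟩ := T.across_D_c h (i := i₅) fun k hk => hCA k i₁ (hU.symm.trans hk.symm)
  have hCC : T.across (i₅, 2, false) = (k, 2, false) := T.across_flip_eq hDD
  have hP : T.vertexType (T.corner i₅ 2) 1 = 0 := by
    rcases hC i₅ with hv | hv
    · exact absurd hCC (T.across_C_ne_C h hv)
    · exact hv.2.1
  obtain ⟨i₆, h65, h56⟩ := T.across_C_b h (i := i₅) (hnot hP)
  have h56' : T.across (i₅, 1, false) = (i₆, 1, false) := T.across_flip_eq h56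
  have hW' : T.corner i₆ 1 = T.corner i₅ 1 := T.pt_eq_of_across h56'
  -- A corner `B` is adjacent across `AB` to the corner `A` of the vertex `αβ²`.
  have hBA : ∀ i, ∃ k, T.across (i, 0, true) = (k, 0, false) ∨
      T.across (i, 0, true) = (k, 3, true) := by
    intro i
    obtain ⟨k, -, he | he | he | he⟩ := T.across_a_cases h i (Or.inl rfl) true
    · exact ⟨k, Or.inl he⟩
    · exact ⟨k, Or.inr he⟩
    · exact absurd he (T.across_B_ne_B h (hB i))
    · exact absurd (T.pt_eq_of_across he) (hBD i k)
  obtain ⟨i₇, h57⟩ : ∃ k, T.across (i₅, 0, true) = (k, 0, false) := by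
    obtain ⟨k, hk | hk⟩ := hBA i₅
    · exact ⟨k, hk⟩
    · exfalso
      have hp : T.corner k 3 = T.corner i₅ 0 := T.pt_eq_of_across (T.across_flip_eq hk)
      exact hBD i₁ k (hp.trans hW)
  have h57' : T.across (i₅, 0, false) = (i₇, 0, true) := T.across_flip_eq h57
  have hA7 : T.corner i₇ 0 = T.corner i₅ 1 := T.pt_eq_of_across h57
  have hB7 : T.corner i₇ 1 = T.corner i₁ 1 := (T.pt_eq_of_across h57').trans hW
  have h67 : T.across (i₆, 0, true) = (i₇, 3, true) := by
    obtain ⟨k, hk⟩ := hBA i₆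
    have hpk : T.corner k 0 = T.corner i₅ 1 := by
      rcases hk with hk | hk
      · exact (T.pt_eq_of_across hk).trans hW'
      · exact (T.pt_eq_of_across hk).trans hW'
    have hk7 : k = i₇ :=
      T.corner_eq_of_one (p := T.corner i₅ 1) (j := 0) (by rw [hB]; rfl) hpk hA7
    subst hk7
    rcases hk with hk | hk
    · exfalso
      have := (T.across_eq_comm hk).symm.trans (T.across_eq_comm h57)
      exact h65 (congrArg Prod.fst this)
    · exact hk
  have hU' : T.corner i₇ 3 = T.corner i₆ 0 := T.pt_eq_of_across (T.across_flip_eq h67)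
  -- The tile `i₇` has its corner `C` at a vertex `γ^m`, too.
  obtain ⟨k', -, hDD'⟩ := T.across_D_c h (i := i₇) fun k hk => hCA k i₆ (hU'.symm.trans hk.symm)
  have hCC' : T.across (i₇, 2, false) = (k', 2, false) := T.across_flip_eq hDD'
  have hZ : T.vertexType (T.corner i₇ 2) 3 = 0 := by
    rcases hC i₇ with hv | hv
    · exact absurd hCC' (T.across_C_ne_C h hv)
    · exact hv.2.2
  -- The tiles `i₁` and `i₇` share this vertex, so that the corners `D` are adjacent across `CD`.
  have h71 : i₇ ≠ i₁ := by
    rintro rfl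
    have := (T.across_eq_comm h57').symm.trans h15'
    simp at this
  obtain ⟨l, hl1, h1l⟩ := T.across_B_b h (i := i₁) (hBC i₁)
  have hl7 : l = i₇ := T.corner_eq_of_two (p := T.corner i₁ 1) (j := 1) (by rw [hB]; rfl) rfl hB7
    (T.pt_eq_of_across h1l) h71 hl1
  subst hl7
  have hZ1 : T.corner l 2 = T.corner i₁ 2 := T.pt_eq_of_across (T.across_flip_eq h1l)
  rw [hZ1] at hZ
  obtain ⟨m, -, hm⟩ := T.across_C_c h (i := i₁) (hnot hZ)
  exact T.across_D_ne_D h hq (T.across_flip_eq hm)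

end edges

/-! ### Counting -/

/-- The vertices of the tiling. -/
noncomputable def vertices : Finset S2 :=
  open Classical in Finset.univ.image fun c : Fin f × Fin 4 => T.corner c.1 c.2

lemma mem_vertices {p : S2} : p ∈ T.vertices ↔ ∃ x : TileFlag f, T.pt x = p := by
  classical
  rw [vertices, Finset.mem_image]
  constructor
  · rintro ⟨⟨i, j⟩, -, rfl⟩
    exact ⟨(i, j, false), rfl⟩
  · rintro ⟨x, rfl⟩
    exact ⟨(x.1, x.idx), Finset.mem_univ _, rfl⟩

lemma sum_vertexType (j : Fin 4) : ∑ p ∈ T.vertices, T.vertexType p j = f := by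
  classical
  have := Finset.card_eq_sum_card_fiberwise (s := (Finset.univ : Finset (Fin f)))
    (t := T.vertices) (f := fun i => T.corner i j) fun i _ =>
      T.mem_vertices.mpr ⟨(i, j, false), rfl⟩
  rw [Finset.card_univ, Fintype.card_fin] at this
  refine Eq.trans (Finset.sum_congr rfl fun p _ => ?_) this.symm
  rw [vertexType, Set.ncard_eq_toFinset_card']
  congr 1
  ext i; simp

/-- Around a vertex, the flags of an edge type that only occurs once in the tile are matched in
pairs. -/
lemma even_vertexType_add {e : Fin 4} (p : S2) (he : ∀ x : TileFlag f, x.2.1 = e →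
    (T.across x).2.1 = e) : Even (T.vertexType p e + T.vertexType p (e + 1)) := by
  classical
  set S : Finset (TileFlag f) := Finset.univ.filter fun x => T.pt x = p ∧ x.2.1 = e with hS
  have hcard : S.card = T.vertexType p e + T.vertexType p (e + 1) := by
    have h1 : S = (Finset.univ.filter fun i => T.corner i e = p).image
        (fun i => ((i, e, false) : TileFlag f)) ∪
        (Finset.univ.filter fun i => T.corner i (e + 1) = p).image
        (fun i => ((i, e, true) : TileFlag f)) := by
      ext ⟨i, e', s⟩
      rw [hS, Finset.mem_filter, Finset.mem_union, Finset.mem_image, Finset.mem_image]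
      constructor
      · rintro ⟨-, hp, rfl⟩
        cases s
        · exact Or.inl ⟨i, Finset.mem_filter.mpr ⟨Finset.mem_univ _, hp⟩, rfl⟩
        · exact Or.inr ⟨i, Finset.mem_filter.mpr ⟨Finset.mem_univ _, hp⟩, rfl⟩
      · rintro (⟨k, hk, hke⟩ | ⟨k, hk, hke⟩)
        · obtain ⟨rfl, rfl, rfl⟩ : k = i ∧ e = e' ∧ false = s := by simpa using hke
          exact ⟨Finset.mem_univ _, (Finset.mem_filter.mp hk).2, rfl⟩
        · obtain ⟨rfl, rfl, rfl⟩ : k = i ∧ e = e' ∧ true = s := by simpa using hke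
          exact ⟨Finset.mem_univ _, (Finset.mem_filter.mp hk).2, rfl⟩
    rw [h1, Finset.card_union_of_disjoint, Finset.card_image_of_injective,
      Finset.card_image_of_injective]
    · rw [vertexType, vertexType, Set.ncard_eq_toFinset_card', Set.ncard_eq_toFinset_card']
      congr 2 <;> (ext i; simp)
    · intro a b hab; simpa using hab
    · intro a b hab; simpa using hab
    · rw [Finset.disjoint_left]
      intro x hx hx'
      obtain ⟨a, -, rfl⟩ := Finset.mem_image.mp hx
      obtain ⟨b, -, hb⟩ := Finset.mem_image.mp hx'
      simp at hb
  rw [← hcard]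
  have hsum : ∑ x ∈ S, (1 : ZMod 2) = 0 := by
    refine Finset.sum_involution (fun x _ => T.across x) (fun _ _ => by decide)
      (fun x _ _ => T.across_ne x) (fun x hx => ?_) (fun x _ => T.across_across x)
    rw [hS, Finset.mem_filter] at hx ⊢
    exact ⟨Finset.mem_univ _, by rw [T.pt_across, hx.2.1], he x hx.2.2⟩
  rw [Finset.sum_const, nsmul_one] at hsum
  exact (ZMod.natCast_eq_zero_iff_even).mp hsum

end SphericalTiling

/-! ### The possible vertices -/

/-- The vertices that are compatible with the angle sum when `α < π`. -/
lemma vertex_cases {a b c d : ℝ} {k l m n : ℕ} (hab : a + 2 * b = 2 * π) (hcd : c + d = π)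
    (ha : 0 < a) (haπ : a < π) (hb : 0 < b) (hc : 0 < c) (hd : 0 < d)
    (hsum : k * a + l * b + m * c + n * d = 2 * π) (hlm : Even (l + m)) (hmn : Even (m + n))
    (hdeg : 3 ≤ k + l + m + n) :
    (k = 1 ∧ l = 2 ∧ m = 0 ∧ n = 0) ∨ (k = 0 ∧ l = 2 ∧ n = 0 ∧ 2 ≤ m ∧ m * c = a) ∨
    (k = 0 ∧ l = 2 ∧ m = 0 ∧ 2 ≤ n ∧ n * d = a) ∨
    (k = 0 ∧ l = 1 ∧ n = 1 ∧ 3 ≤ m ∧ (m - 1 : ℝ) * c = a / 2) ∨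
    (k = 0 ∧ l = 1 ∧ m = 1 ∧ 3 ≤ n ∧ (n - 1 : ℝ) * d = a / 2) ∨
    (k = 0 ∧ l = 0 ∧ m = 2 ∧ n = 2) ∨ (l = 0 ∧ m = 0 ∧ Even n ∧ k * a + n * d = 2 * π) ∨
    (l = 0 ∧ n = 0 ∧ Even m ∧ k * a + m * c = 2 * π) := by
  have hge : ∀ (N q : ℕ) {x : ℝ}, 0 < x → N ≤ q → (N : ℝ) * x ≤ q * x := fun N q x hx h =>
    mul_le_mul_of_nonneg_right (by exact_mod_cast h) hx.le
  have hk0 := hge 0 k ha (Nat.zero_le _)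
  have hl0 := hge 0 l hb (Nat.zero_le _)
  have hm0 := hge 0 m hc (Nat.zero_le _)
  have hn0 := hge 0 n hd (Nat.zero_le _)
  rw [Nat.even_iff] at hlm hmn
  have hl4 : l < 4 := by
    by_contra hcon
    have := hge 4 l hb (by omega)
    push_cast at *
    linarith
  push_cast at hk0 hl0 hm0 hn0
  interval_cases l
  · rcases Nat.eq_zero_or_pos m with rfl | hm
    · refine Or.inr (Or.inr (Or.inr (Or.inr (Or.inr (Or.inr (Or.inl ⟨rfl, rfl, ?_, ?_⟩))))))
      · rw [Nat.even_iff]; omega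
      · push_cast at hsum; linarith
    rcases Nat.eq_zero_or_pos n with rfl | hn
    · refine Or.inr (Or.inr (Or.inr (Or.inr (Or.inr (Or.inr (Or.inr ⟨rfl, rfl, ?_, ?_⟩))))))
      · rw [Nat.even_iff]; omega
      · push_cast at hsum; linarith
    refine Or.inr (Or.inr (Or.inr (Or.inr (Or.inr (Or.inl ?_)))))
    have hm2 := hge 2 m hc (by omega)
    have hn2 := hge 2 n hd (by omega)
    push_cast at hm2 hn2 hsum
    refine ⟨?_, rfl, ?_, ?_⟩
    · by_contra hcon
      have := hge 1 k ha (by omega)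
      push_cast at this
      linarith
    · by_contra hcon
      have := hge 3 m hc (by omega)
      push_cast at this
      linarith
    · by_contra hcon
      have := hge 3 n hd (by omega)
      push_cast at this
      linarith
  · have hm1 := hge 1 m hc (by omega)
    have hn1 := hge 1 n hd (by omega)
    push_cast at hm1 hn1 hsum
    have hk : k = 0 := by
      by_contra hcon
      have := hge 1 k ha (by omega)
      push_cast at this
      linarith
    subst hk
    push_cast at hsum
    by_cases hm3 : 3 ≤ m
    · have hn : n = 1 := by
        by_contra hcon
        have h1 := hge 3 m hc hm3
        have h2 := hge 3 n hd (by omega)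
        push_cast at h1 h2
        linarith
      subst hn
      push_cast at hsum
      exact Or.inr (Or.inr (Or.inr (Or.inl ⟨rfl, rfl, rfl, hm3, by linarith⟩)))
    · have hm : m = 1 := by omega
      subst hm
      push_cast at hsum
      refine Or.inr (Or.inr (Or.inr (Or.inr (Or.inl ⟨rfl, rfl, rfl, ?_, by linarith⟩))))
      by_contra hcon
      have hn : n = 1 := by omega
      subst hn
      push_cast at hsum
      linarith
  · push_cast at hsum
    by_cases hk : k = 0
    · subst hk
      push_cast at hsum
      rcases Nat.eq_zero_or_pos m with rfl | hm
      · push_cast at hsum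
        exact Or.inr (Or.inr (Or.inl ⟨rfl, rfl, rfl, by omega, by linarith⟩))
      rcases Nat.eq_zero_or_pos n with rfl | hn
      · push_cast at hsum
        exact Or.inr (Or.inl ⟨rfl, rfl, rfl, by omega, by linarith⟩)
      have h1 := hge 2 m hc (by omega)
      have h2 := hge 2 n hd (by omega)
      push_cast at h1 h2
      linarith
    · left
      have h1 := hge 1 k ha (by omega)
      push_cast at h1
      refine ⟨?_, rfl, ?_, ?_⟩
      · by_contra hcon
        have := hge 2 k ha (by omega)
        push_cast at this
        linarith
      · by_contra hcon
        have := hge 1 m hc (by omega)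
        push_cast at this
        linarith
      · by_contra hcon
        have := hge 1 n hd (by omega)
        push_cast at this
        linarith
  · have hm1 := hge 1 m hc (by omega)
    have hn1 := hge 1 n hd (by omega)
    push_cast at hm1 hn1 hsum
    linarith

/-- The vertices with a corner `A` that are compatible with the angle sum when `π ≤ α`. -/
lemma vertex_cases_of_pi_le {a b c d : ℝ} {k l m n : ℕ} (hab : a + 2 * b = 2 * π)
    (hcd : c + d = π) (haπ : π ≤ a) (hb : 0 < b) (hc : 0 < c) (hd : 0 < d)
    (hsum : k * a + l * b + m * c + n * d = 2 * π) (hlm : Even (l + m)) (hmn : Even (m + n))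
    (hdeg : 3 ≤ k + l + m + n) (hk : k ≠ 0) :
    k = 1 ∧ (l = 2 ∧ m = 0 ∧ n = 0 ∨ l = 0 ∧ m = 0 ∧ Even n ∧ n * d = 2 * b ∨
      l = 0 ∧ n = 0 ∧ m ≠ 0) := by
  have hge : ∀ (N q : ℕ) {x : ℝ}, 0 < x → N ≤ q → (N : ℝ) * x ≤ q * x := fun N q x hx h =>
    mul_le_mul_of_nonneg_right (by exact_mod_cast h) hx.le
  have hπ := pi_pos
  have ha : 0 < a := by linarith
  have hl0 := hge 0 l hb (Nat.zero_le _)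
  have hm0 := hge 0 m hc (Nat.zero_le _)
  have hn0 := hge 0 n hd (Nat.zero_le _)
  rw [Nat.even_iff] at hlm hmn
  push_cast at hl0 hm0 hn0
  have hk1 : k = 1 := by
    by_contra hcon
    have h2 := hge 2 k ha (by omega)
    push_cast at h2
    -- Two angles `α` already fill the vertex, which would have degree two.
    have h3 : 1 ≤ l ∨ 1 ≤ m ∨ 1 ≤ n ∨ 3 ≤ k := by omega
    rcases h3 with h3 | h3 | h3 | h3
    · have := hge 1 l hb h3; push_cast at this; linarith
    · have := hge 1 m hc h3; push_cast at this; linarith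
    · have := hge 1 n hd h3; push_cast at this; linarith
    · have := hge 3 k ha h3; push_cast at this; linarith
  subst hk1
  push_cast at hsum
  refine ⟨rfl, ?_⟩
  have hmn0 : m = 0 ∨ n = 0 := by
    by_contra hcon
    push Not at hcon
    have h1 := hge 1 m hc (by omega)
    have h2 := hge 1 n hd (by omega)
    push_cast at h1 h2
    by_cases hodd : m % 2 = 1
    · have := hge 1 l hb (by omega)
      push_cast at this
      linarith
    · have h3 := hge 2 m hc (by omega)
      have h4 := hge 2 n hd (by omega)
      push_cast at h3 h4
      linarith
  have hl2 : l ≤ 2 := by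
    by_contra hcon
    have := hge 3 l hb (by omega)
    push_cast at this
    linarith
  have hl1 : l = 0 ∨ l = 2 := by omega
  rcases hl1 with rfl | rfl
  · right
    push_cast at hsum
    rcases hmn0 with rfl | rfl
    · left
      push_cast at hsum
      exact ⟨rfl, rfl, by rw [Nat.even_iff]; omega, by linarith⟩
    · right
      exact ⟨rfl, rfl, by omega⟩
  · left
    push_cast at hsum
    refine ⟨rfl, ?_, ?_⟩
    · by_contra hcon
      have := hge 1 m hc (by omega)
      push_cast at this
      linarith
    · by_contra hcon
      have := hge 1 n hd (by omega)
      push_cast at this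
      linarith

namespace SphericalTiling

variable {f : ℕ} (T : SphericalTiling f)

lemma angle_sum_four (x : TileFlag f) :
    T.vertexType (T.pt x) 0 * T.α + T.vertexType (T.pt x) 1 * T.β +
      T.vertexType (T.pt x) 2 * T.γ + T.vertexType (T.pt x) 3 * T.δ = 2 * π := by
  have := T.angle_sum x
  rwa [Fin.sum_univ_four] at this

lemma three_le_degree (x : TileFlag f) : 3 ≤ T.vertexType (T.pt x) 0 + T.vertexType (T.pt x) 1 +
    T.vertexType (T.pt x) 2 + T.vertexType (T.pt x) 3 := by
  have := T.degree_ge_three x.1 x.idx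
  rwa [Fin.sum_univ_four] at this

lemma vertexType_eq {p : S2} {k l m n : ℕ} (h0 : T.vertexType p 0 = k) (h1 : T.vertexType p 1 = l)
    (h2 : T.vertexType p 2 = m) (h3 : T.vertexType p 3 = n) : T.vertexType p = ![k, l, m, n] := by
  funext j
  fin_cases j
  · exact h0
  · exact h1
  · exact h2
  · exact h3

section main

variable (h : T.tile.IsA2BC)
include h

lemma even_BC (p : S2) : Even (T.vertexType p 1 + T.vertexType p 2) :=
  T.even_vertexType_add p (e := 1) fun ⟨i, e, s⟩ he => by
    change e = 1 at he
    subst he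
    obtain ⟨k, s', -, hx⟩ := T.across_b h i s
    rw [hx]

lemma even_CD (p : S2) : Even (T.vertexType p 2 + T.vertexType p 3) :=
  T.even_vertexType_add p (e := 2) fun ⟨i, e, s⟩ he => by
    change e = 2 at he
    subst he
    obtain ⟨k, s', -, hx⟩ := T.across_c h i s
    rw [hx]

/-- There is no vertex `α^k γ^m`, since the sides of `A` and `C` do not match. -/
lemma C_eq_zero {p : S2} (hA : T.vertexType p 0 ≠ 0) (hB : T.vertexType p 1 = 0)
    (hD : T.vertexType p 3 = 0) : T.vertexType p 2 = 0 := by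
  by_contra hC
  obtain ⟨i, rfl⟩ := T.exists_corner_of_ne_zero hA
  obtain ⟨k, hk⟩ := T.exists_corner_of_ne_zero hC
  have := T.idx_eq_zero h (fun l hl => T.vertexType_ne_zero l 1 (by rw [hl, hB]))
    (fun l hl => T.vertexType_ne_zero l 3 (by rw [hl, hD])) hk
  exact absurd this (by decide)

lemma beta_ne_delta (hcd : T.γ + T.δ = π) : T.β ≠ T.δ := by
  intro hbd
  have hγ := T.tile.angle_pos 2
  have hδ := T.tile.angle_pos 3
  exact h.2.2.2 (T.tile.len_eq_of_angle_eq h.1 hbd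
    (sin_pos_of_pos_of_lt_pi hγ (by unfold γ δ at hcd; linarith)).ne')

/-- If `α ≥ π`, then every corner `A` is at a vertex `αβ²` or `αδⁿ` with `n ≥ 4`, so that there are
more corners `B` and `D` than there can be. -/
lemma alpha_lt_pi (hab : T.α + 2 * T.β = 2 * π) (hcd : T.γ + T.δ = π) (hf : 0 < f) :
    T.α < π := by
  by_contra hα
  push Not at hα
  have hle : ∀ p ∈ T.vertices,
      4 * T.vertexType p 0 ≤ 2 * T.vertexType p 1 + T.vertexType p 3 := by
    intro p hp
    obtain ⟨x, rfl⟩ := T.mem_vertices.mp hp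
    by_cases hk : T.vertexType (T.pt x) 0 = 0
    · omega
    have hdeg := T.three_le_degree x
    obtain ⟨h1, ⟨h2, h3, h4⟩ | ⟨h2, h3, h4, h5⟩ | ⟨h2, h3, h4⟩⟩ :=
      vertex_cases_of_pi_le hab hcd hα (T.tile.angle_pos 1) (T.tile.angle_pos 2)
        (T.tile.angle_pos 3) (T.angle_sum_four x) (T.even_BC h _) (T.even_CD h _) hdeg hk
    · omega
    · have hne : T.vertexType (T.pt x) 3 ≠ 2 := by
        intro e
        rw [e] at h5
        push_cast at h5
        exact T.beta_ne_delta h hcd (by linarith)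
      rw [Nat.even_iff] at h4
      omega
    · exact absurd (T.C_eq_zero h hk h2 h3) h4
  have hsum := Finset.sum_le_sum hle
  rw [Finset.sum_add_distrib, ← Finset.mul_sum, ← Finset.mul_sum, T.sum_vertexType,
    T.sum_vertexType, T.sum_vertexType] at hsum
  omega

/-- A vertex with `B` is `αβ²`, and a vertex with `C` is `γ²δ²` or `γ^m`. -/
lemma vertices_B_C (hab : T.α + 2 * T.β = 2 * π) (hcd : T.γ + T.δ = π) (hα : T.α < π) :
    ∀ p ∈ T.vertices, (T.vertexType p 1 ≠ 0 → T.vertexType p = ![1, 2, 0, 0]) ∧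
      (T.vertexType p 2 ≠ 0 → T.vertexType p = ![0, 0, 2, 2] ∨ (T.vertexType p 0 = 0 ∧
        T.vertexType p 1 = 0 ∧ T.vertexType p 3 = 0)) := by
  have ha : 0 < T.α := T.tile.angle_pos 0
  have hb : 0 < T.β := T.tile.angle_pos 1
  have hc : 0 < T.γ := T.tile.angle_pos 2
  have hd : 0 < T.δ := T.tile.angle_pos 3
  have hge : ∀ (N q : ℕ) {x : ℝ}, 0 < x → N ≤ q → (N : ℝ) * x ≤ q * x := fun N q x hx h =>
    mul_le_mul_of_nonneg_right (by exact_mod_cast h) hx.le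
  have hcases := fun x => vertex_cases hab hcd ha hα hb hc hd (T.angle_sum_four x)
    (T.even_BC h _) (T.even_CD h _) (T.three_le_degree x)
  rcases lt_or_ge (π / 2) T.γ with hγ | hγ
  · -- There are no more corners `C` than corners `D` at each vertex, hence equally many.
    have hle : ∀ p ∈ T.vertices, T.vertexType p 2 ≤ T.vertexType p 3 := by
      intro p hp
      obtain ⟨x, rfl⟩ := T.mem_vertices.mp hp
      rcases hcases x with h1 | h1 | h1 | h1 | h1 | h1 | h1 | h1
      · omega
      · obtain ⟨-, -, -, h2, h3⟩ := h1
        have := hge 2 _ hc h2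
        push_cast at this
        linarith
      · omega
      · obtain ⟨-, -, -, h2, h3⟩ := h1
        have := hge 3 _ hc h2
        push_cast at this
        linarith
      · omega
      · omega
      · omega
      · obtain ⟨h2, h3, h4, h5⟩ := h1
        by_contra hcon
        have hk : T.vertexType (T.pt x) 0 = 0 := by
          by_contra hk
          have := T.C_eq_zero h hk h2 h3
          omega
        have hdeg := T.three_le_degree x
        rw [Nat.even_iff] at h4
        have := hge 4 _ hc (show 4 ≤ T.vertexType (T.pt x) 2 by omega)
        rw [hk] at h5
        push_cast at this h5
        linarith
    have heq := (Finset.sum_eq_sum_iff_of_le hle).mp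
      ((T.sum_vertexType 2).trans (T.sum_vertexType 3).symm)
    intro p hp
    have hp2 := heq p hp
    obtain ⟨x, rfl⟩ := T.mem_vertices.mp hp
    rcases hcases x with h1 | h1 | h1 | h1 | h1 | h1 | h1 | h1
    · exact ⟨fun _ => T.vertexType_eq h1.1 h1.2.1 h1.2.2.1 h1.2.2.2, fun h2 => by omega⟩
    · omega
    · omega
    · omega
    · omega
    · exact ⟨fun h2 => by omega, fun _ => Or.inl (T.vertexType_eq h1.1 h1.2.1 h1.2.2.1 h1.2.2.2)⟩
    · exact ⟨fun h2 => by omega, fun h2 => by omega⟩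
    · exact ⟨fun h2 => by omega, fun h2 => by omega⟩
  -- The borderline case `γ = α / 2` of the next distinction means `β = δ`.
  rcases lt_trichotomy (T.α / 2) T.γ with hαγ | hαγ | hαγ
  · intro p hp
    obtain ⟨x, rfl⟩ := T.mem_vertices.mp hp
    rcases hcases x with h1 | h1 | h1 | h1 | h1 | h1 | h1 | h1
    · exact ⟨fun _ => T.vertexType_eq h1.1 h1.2.1 h1.2.2.1 h1.2.2.2, fun h2 => by omega⟩
    · obtain ⟨-, -, -, h2, h3⟩ := h1
      have := hge 2 _ hc h2
      push_cast at this
      linarith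
    · obtain ⟨-, -, -, h2, h3⟩ := h1
      have := hge 2 _ hd h2
      push_cast at this
      linarith
    · obtain ⟨-, -, -, h2, h3⟩ := h1
      have := hge 3 _ hc h2
      push_cast at this
      linarith
    · obtain ⟨-, -, -, h2, h3⟩ := h1
      have := hge 3 _ hd h2
      push_cast at this
      linarith
    · exact ⟨fun h2 => by omega, fun _ => Or.inl (T.vertexType_eq h1.1 h1.2.1 h1.2.2.1 h1.2.2.2)⟩
    · exact ⟨fun h2 => by omega, fun h2 => by omega⟩
    · obtain ⟨h2, h3, -, -⟩ := h1
      refine ⟨fun h4 => by omega, fun h4 => Or.inr ⟨?_, h2, h3⟩⟩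
      by_contra hk
      exact h4 (T.C_eq_zero h hk h2 h3)
  · exact absurd (by linarith) (T.beta_ne_delta h hcd)
  -- No two corners `D` are adjacent across the edge of length `c`.
  have hDD : ∀ i k, T.across (i, 2, true) ≠ (k, 2, true) := by
    intro i k hik
    have hki := T.fst_ne_of_across hik
    have hp : T.corner k 3 = T.corner i 3 := T.pt_eq_of_across hik
    have hn := T.vertexType_ne_zero i 3
    rcases hcases (i, 2, true) with h1 | h1 | h1 | h1 | h1 | h1 | h1 | h1
    · exact hn h1.2.2.2
    · exact hn h1.2.2.1
    · obtain ⟨-, -, -, h2, h3⟩ := h1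
      have := hge 2 _ hd h2
      push_cast at this
      linarith
    · exact hki (T.corner_eq_of_one (p := T.corner i 3) h1.2.2.1 hp rfl)
    · obtain ⟨-, -, -, h2, h3⟩ := h1
      have := hge 3 _ hd h2
      push_cast at this
      linarith
    · exact T.across_D_ne_D h (T.vertexType_eq h1.1 h1.2.1 h1.2.2.1 h1.2.2.2) hik
    · obtain ⟨h2, h3, h4, h5⟩ := h1
      have hdeg := T.three_le_degree (i, 2, true)
      change T.vertexType (T.pt (i, 2, true)) 3 ≠ 0 at hn
      rw [Nat.even_iff] at h4
      have hn2 := hge 2 _ hd (show 2 ≤ T.vertexType (T.pt (i, 2, true)) 3 by omega)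
      push_cast at hn2
      by_cases hk : T.vertexType (T.pt (i, 2, true)) 0 = 0
      · have hn4 := hge 4 _ hd (show 4 ≤ T.vertexType (T.pt (i, 2, true)) 3 by omega)
        rw [hk] at h5
        push_cast at hn4 h5
        linarith
      · have hk1 := hge 1 _ ha (show 1 ≤ T.vertexType (T.pt (i, 2, true)) 0 by omega)
        push_cast at hk1
        linarith
    · exact hn h1.2.1
  -- Hence each corner `C` is adjacent to a corner `D` across this edge.
  have hCD : ∀ i, ∃ k, T.across (i, 2, false) = (k, 2, true) := by
    intro i
    obtain ⟨k, s, -, hk⟩ := T.across_c h i false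
    cases s
    · exact absurd (T.across_flip_eq hk) (hDD i k)
    · exact ⟨k, hk⟩
  have hn0 : ∀ p, T.vertexType p 2 ≠ 0 → T.vertexType p 3 ≠ 0 := by
    intro p hm hn
    obtain ⟨i, rfl⟩ := T.exists_corner_of_ne_zero hm
    obtain ⟨k, hk⟩ := hCD i
    exact T.vertexType_ne_zero k 3 (by rwa [show T.corner k 3 = T.corner i 2 from
      T.pt_eq_of_across hk])
  have hn1 : ∀ p, 3 ≤ T.vertexType p 2 → T.vertexType p 3 ≠ 1 := by
    intro p hm hn
    obtain ⟨i, hi, k, hk, hik⟩ := (Set.one_lt_ncard (Set.toFinite _)).mp (show 1 < T.vertexType p 2 by omega)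
    obtain ⟨i', hi'⟩ := hCD i
    obtain ⟨k', hk'⟩ := hCD k
    have hik' : i' = k' := T.corner_eq_of_one hn ((T.pt_eq_of_across hi').trans hi)
      ((T.pt_eq_of_across hk').trans hk)
    rw [hik'] at hi'
    exact hik (congrArg Prod.fst ((T.across_eq_comm hi').symm.trans (T.across_eq_comm hk')))
  intro p hp
  obtain ⟨x, rfl⟩ := T.mem_vertices.mp hp
  rcases hcases x with h1 | h1 | h1 | h1 | h1 | h1 | h1 | h1
  · exact ⟨fun _ => T.vertexType_eq h1.1 h1.2.1 h1.2.2.1 h1.2.2.2, fun h2 => by omega⟩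
  · exact absurd h1.2.2.1 (hn0 _ (by omega))
  · obtain ⟨-, -, -, h2, h3⟩ := h1
    have := hge 2 _ hd h2
    push_cast at this
    linarith
  · exact absurd h1.2.2.1 (hn1 _ h1.2.2.2.1)
  · obtain ⟨-, -, -, h2, h3⟩ := h1
    have := hge 3 _ hd h2
    push_cast at this
    linarith
  · exact ⟨fun h2 => by omega, fun _ => Or.inl (T.vertexType_eq h1.1 h1.2.1 h1.2.2.1 h1.2.2.2)⟩
  · exact ⟨fun h2 => by omega, fun h2 => by omega⟩
  · exact ⟨fun h2 => by omega, fun h2 => absurd h1.2.1 (hn0 _ h2)⟩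

/-- The vertices `αβ²` and `γ²δ²` do not both occur. -/
lemma not_both_vertices (h1 : ![1, 2, 0, 0] ∈ T.avc) (h2 : ![0, 0, 2, 2] ∈ T.avc) : False := by
  obtain ⟨i, j, hij⟩ := h1
  obtain ⟨i', j', hij'⟩ := h2
  have hab := T.angle_sum_four (i, j, false)
  have hcd := T.angle_sum_four (i', j', false)
  change T.vertexType (T.corner i j) 0 * T.α + T.vertexType (T.corner i j) 1 * T.β +
    T.vertexType (T.corner i j) 2 * T.γ + T.vertexType (T.corner i j) 3 * T.δ = 2 * π at hab
  change T.vertexType (T.corner i' j') 0 * T.α + T.vertexType (T.corner i' j') 1 * T.β +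
    T.vertexType (T.corner i' j') 2 * T.γ + T.vertexType (T.corner i' j') 3 * T.δ = 2 * π at hcd
  rw [← hij] at hab
  rw [← hij'] at hcd
  simp at hab hcd
  have hcd' : T.γ + T.δ = π := by linarith
  have hv := T.vertices_B_C h hab hcd' (T.alpha_lt_pi h hab hcd' i.pos)
  obtain ⟨k, hk⟩ := T.exists_corner_of_ne_zero (p := T.corner i' j') (j := 3)
    (by rw [← hij']; decide)
  refine T.no_vertex_CCDD h (fun l => ?_) (fun l => ?_) k (by rw [hk, hij'])
  · exact (hv _ (T.mem_vertices.mpr ⟨(l, 1, false), rfl⟩)).1 (T.vertexType_ne_zero l 1)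
  · exact (hv _ (T.mem_vertices.mpr ⟨(l, 2, false), rfl⟩)).2 (T.vertexType_ne_zero l 2)

end main

end SphericalTiling

theorem mainTheorem6 :
    (∀ (f : ℕ) (T : SphericalTiling f), T.tile.IsA2BC →
      ![1, 2, 0, 0] ∈ T.avc → ![0, 0, 2, 2] ∈ T.avc →
        8 < f ∧ T.δ < T.β ∧ π / 2 ≤ T.δ ∧
        T.avc ⊆ {![1, 2, 0, 0], ![0, 0, 2, 2], ![2, 0, 0, 2]} ∪
          {m | ∃ c : ℕ, 3 ≤ c ∧ Even c ∧ m = ![0, 0, c, 0]}) ∧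
    ¬ ∃ (f : ℕ) (T : SphericalTiling f), T.tile.IsA2BC ∧
      ![1, 2, 0, 0] ∈ T.avc ∧ ![0, 0, 2, 2] ∈ T.avc := by
  constructor
  -- The hypotheses of the first part cannot be met, by the second part.
  · intro f T h h1 h2
    exact (T.not_both_vertices h h1 h2).elim
  · rintro ⟨f, T, h, h1, h2⟩
    exact T.not_both_vertices h h1 h2
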